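/- Let $\mathfrak P$ be a finite-dimensional projective space over a field of characteristic $\neq 2$, let $T,B$ be complementary subspaces of $\mathfrak P$, and let $Q$ be a nondegenerate quadric on $B$ which contains a line. Assume that $T\neq\emptyset$ or that the projective dimension of $B$ is at least $4$. Let $S_0$ be the cone with vertex $T$ over $Q$ and $S=S_0\setminus T$. Put: - $\mathcal L$: all nonempty sets $S\cap\ell$, where $\ell$ is a line of $\mathfrak P$ contained in $S_0$; $\mathcal G\subseteq\mathcal L$ (projective lines): those with $\ell\cap T=\emptyset$; - $\mathcal C$ (cycles): all sets $S\cap A$, $A$ a plane of $\mathfrak P$, that have more than one point and contain no member of $\mathcal L$; - $\mathfrak g^m_d$: all sets $S\cap H$, where $H\subseteq S_0$ is an $(m+d)$-dimensional subspace of $\mathfrak P$ with $H\not\subseteq T$ and $\dim(H\cap T)=m-1$; - $\mathfrak s^{m,m'}_{d,w}$: all sets $S\cap H$, where $H$ is the span of disjoint subspaces $W,D$ such that $D\cap S_0$ is a nondegenerate $d$-dimensional quadric of index $w$ on the $(d+1)$-dimensional space $D$ (the index is the largest dimension of a subspace contained in the quadric), $H\cap S_0$ is the cone with vertex $W$ over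 $D\cap S_0$, $\dim(W\cap T)=m-1$, and $\dim W=m+m'-w-1$; further $\mathfrak l^m_{d,w}=\mathfrak s^{m,w}_{d,w}$ and $\mathfrak d^m_{d,w}=\mathfrak s^{0,m}_{d,w}$. (The empty subspace has dimension $-1$.) In particular, $\mathfrak d^1_{1,0}$ is the set of projective cones contained in $S$: cones over a conic with a single vertex point, which lies in $S$, all generators of which belong to $\mathcal G$. Let $\wp_1=\mathcal C\cup\mathcal L$ and $\wp_2=\mathfrak g^0_2\cup\mathfrak g^1_1\cup\mathfrak g^2_0\cup\mathfrak l^1_{1,0}\cup\mathfrak d^1_{1,0}\cup\mathfrak l^0_{2,0}\cup\mathfrak l^0_{2,1}$ be the families of one- and two-dimensional subspaces of the generalized Laguerre space $\mathfrak L$ determined by $T,B,Q$. Let $\mathbf{Gr}(1,\mathfrak L)=\langle\wp_1,\wp_2,\subset\rangle$ be its Grassmann space of $1$-subspaces, regarded as a two-sorted first-order structure. Then the structure of "conic" pencils $\langle\mathcal G,\mathfrak d^1_{1,0},\subset\rangle$ is definable in $\mathbf{Gr}(1,\mathfrak L)$: there are first-order formulas without parameters in the language of $\langle\wp_1,\wp_2,\subset\rangle$,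 the same for all such $\mathfrak L$, that define in $\mathbf{Gr}(1,\mathfrak L)$ the set $\mathcal G$ among the elements of $\wp_1$, the set $\mathfrak d^1_{1,0}$ among the elements of $\wp_2$, and the inclusion relation between members of $\mathcal G$ and members of $\mathfrak d^1_{1,0}$. -/

import Mathlib

open Module FirstOrder
open scoped LinearAlgebra.Projectivization

universe u v

/-- The data of a generalized Laguerre space inside the projective space `ℙ K V`: two
complementary subspaces `B` and `T`, and a nondegenerate ruled quadric on `B`, i.e. the zero set of
a nondegenerate quadratic form on `B` that vanishes on some line of `B`. -/
structure GenLaguerre (K : Type u) (V : Type v) [Field K] [AddCommGroup V] [Module K V] where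
  /-- the subspace carrying the base quadric -/
  B : Submodule K V
  /-- the vertex of the cone -/
  T : Submodule K V
  isCompl : IsCompl B T
  /-- the form whose zeros are the base quadric -/
  form : QuadraticForm K B
  nondegenerate : form.Nondegenerate
  ruled : ∃ U : Submodule K B, finrank K U = 2 ∧ ∀ x ∈ U, form x = 0

namespace GenLaguerre

variable {K : Type u} {V : Type v} [Field K] [AddCommGroup V] [Module K V]

/-- The equation of the cone with vertex `T` over the base quadric:
a vector `b + t`, with `b ∈ B` and `t ∈ T`, is on the cone iff `b` is a zero of the form on `B`. -/
noncomputable def coneForm (L : GenLaguerre K V) : QuadraticForm K V :=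
  L.form.comp (L.B.projectionOnto L.T L.isCompl)

/-- The set of points of the projective subspace given by `H`. -/
def pts (H : Submodule K V) : Set (ℙ K V) := {p | p.submodule ≤ H}

/-- `H` is totally singular: the projective subspace given by `H` lies on the cone. -/
def Singular (L : GenLaguerre K V) (H : Submodule K V) : Prop := ∀ x ∈ H, L.coneForm x = 0

/-- The projective cone with vertex `T` over the base quadric. -/
def S₀ (L : GenLaguerre K V) : Set (ℙ K V) := {p | L.Singular p.submodule}

/-- The points of the Laguerre space: the points of the cone that are not in its vertex. -/
def S (L : GenLaguerre K V) : Set (ℙ K V) := L.S₀ \ pts L.T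

/-- The section of the Laguerre space by a projective subspace. -/
def sect (L : GenLaguerre K V) (H : Submodule K V) : Set (ℙ K V) := L.S ∩ pts H

/-- Lines: nonempty sections of `S` with the lines of the projective space that lie on `S₀`. -/
def lines (L : GenLaguerre K V) : Set (Set (ℙ K V)) :=
  {X | ∃ H : Submodule K V, finrank K H = 2 ∧ pts H ⊆ L.S₀ ∧ X = L.sect H ∧ X.Nonempty}

/-- Affine lines: those obtained from projective lines that meet `T`. -/
def affLines (L : GenLaguerre K V) : Set (Set (ℙ K V)) :=
  {X | ∃ H : Submodule K V, finrank K H = 2 ∧ pts H ⊆ L.S₀ ∧ H ⊓ L.T ≠ ⊥ ∧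
    X = L.sect H ∧ X.Nonempty}

/-- Projective lines `𝒢`: the lines on `S₀` that miss `T`. -/
def projLines (L : GenLaguerre K V) : Set (Set (ℙ K V)) :=
  {X | ∃ H : Submodule K V, finrank K H = 2 ∧ pts H ⊆ L.S₀ ∧ H ⊓ L.T = ⊥ ∧ X = L.sect H}

/-- Cycles `𝒞`: the sections of `S` with the planes of the projective space that are nontrivial
(have more than one point) and contain no line. -/
def cycles (L : GenLaguerre K V) : Set (Set (ℙ K V)) :=
  {X | ∃ A : Submodule K V, finrank K A = 3 ∧ X = L.sect A ∧ X.Nontrivial ∧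
    ∀ Y ∈ L.lines, ¬ Y ⊆ X}

/-- The cone cuts the projective subspace given by `D` in a nondegenerate `d`-dimensional quadric
of index `w`: the restricted form is nondegenerate and the greatest projective dimension of a
subspace of `D` on the cone is `w`. -/
def IsQuadric (L : GenLaguerre K V) (d w : ℕ) (D : Submodule K V) : Prop :=
  finrank K D = d + 2 ∧
  (L.coneForm.comp D.subtype).Nondegenerate ∧
  IsGreatest {k | ∃ U : Submodule K V, U ≤ D ∧ L.Singular U ∧ finrank K U = k} (w + 1)

/-- The class `𝔰^{m,m'}_{d,w}`: sections of `S` with the cones whose vertex is `W` and whose basis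
is a nondegenerate `d`-dimensional quadric on `D` of index `w`. The generators of such a cone have
projective dimension `m + m'`, the part of the vertex inside `T` has vector space dimension `m`
(this gives `m`-dimensional affine generators) and the remaining part has dimension `m' - w`. -/
def sClass (L : GenLaguerre K V) (m m' d w : ℕ) : Set (Set (ℙ K V)) :=
  {X | ∃ W D : Submodule K V,
    Disjoint W D ∧ L.IsQuadric d w D ∧
    (∀ x ∈ W, ∀ y ∈ D, L.coneForm (x + y) = L.coneForm y) ∧
    finrank K (W ⊓ L.T : Submodule K V) = m ∧ finrank K W + w = m + m' ∧
    X = L.sect (W ⊔ D)}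

/-- The class `𝔩^m_{d,w}` of affine cones with `m`-dimensional affine generator over a
`d`-dimensional quadric of index `w`. -/
def lClass (L : GenLaguerre K V) (m d w : ℕ) : Set (Set (ℙ K V)) := L.sClass m w d w

/-- The class `𝔡^m_{d,w}` of projective cones with `m`-dimensional projective generator (that is,
with `(m-w-1)`-dimensional vertex) over a `d`-dimensional quadric of index `w`. -/
def dClass (L : GenLaguerre K V) (m d w : ℕ) : Set (Set (ℙ K V)) := L.sClass 0 m d w

/-- The class `𝔤^m_d` of `(m+d)`-dimensional generators whose maximal affine
subgenerators have dimension `m`: sections of `S` with subspaces `H` of projective dimension `m + d`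
that lie on `S₀`, are not contained in `T`, and meet `T` in projective dimension `m - 1`. -/
def gClass (L : GenLaguerre K V) (m d : ℕ) : Set (Set (ℙ K V)) :=
  {X | ∃ H : Submodule K V, finrank K H = m + d + 1 ∧ pts H ⊆ L.S₀ ∧ ¬ H ≤ L.T ∧
    finrank K (H ⊓ L.T : Submodule K V) = m ∧ X = L.sect H}

/-- `℘₁`, the one-dimensional subspaces. -/
def sub₁ (L : GenLaguerre K V) : Set (Set (ℙ K V)) := L.cycles ∪ L.lines

/-- `℘₂`, the two-dimensional subspaces: projective planes, semiaffine planes, affine planes, affine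
cones, projective cones, Möbius planes and Minkowski planes. -/
def sub₂ (L : GenLaguerre K V) : Set (Set (ℙ K V)) :=
  L.gClass 0 2 ∪ L.gClass 1 1 ∪ L.gClass 2 0 ∪ L.lClass 1 1 0 ∪ L.dClass 1 1 0 ∪
    L.lClass 0 2 0 ∪ L.lClass 0 2 1

end GenLaguerre

/-- Relation symbols for two-sorted structures `⟨℘₁, ℘₂, ⊂⟩`. -/
inductive GrassRel : ℕ → Type
  | isSub₁ : GrassRel 1
  | isSub₂ : GrassRel 1
  | incl : GrassRel 2

/-- The first-order language of structures `⟨℘₁, ℘₂, ⊂⟩`: a predicate for each of the two sorts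
and a binary relation symbol for inclusion. -/
def grassLanguage : FirstOrder.Language.{0, 0} := ⟨fun _ => Empty, GrassRel⟩

/-- The universe of the Grassmann space of 1-subspaces, the disjoint union of its two sorts. -/
def GenLaguerre.Gr {K : Type u} {V : Type v} [Field K] [AddCommGroup V] [Module K V]
    (L : GenLaguerre K V) : Type v := L.sub₁ ⊕ L.sub₂

/-- The Grassmann space `⟨℘₁, ℘₂, ⊂⟩` of 1-subspaces as a first-order structure. -/
instance GenLaguerre.grStructure {K : Type u} {V : Type v} [Field K] [AddCommGroup V] [Module K V]
    (L : GenLaguerre K V) : grassLanguage.Structure L.Gr where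
  funMap := fun f _ => Empty.elim f
  RelMap := fun {_} r => match r with
    | .isSub₁ => fun x => ∃ Y : L.sub₁, x 0 = Sum.inl Y
    | .isSub₂ => fun x => ∃ Z : L.sub₂, x 0 = Sum.inr Z
    | .incl => fun x => ∃ (Y : L.sub₁) (Z : L.sub₂),
        x 0 = Sum.inl Y ∧ x 1 = Sum.inr Z ∧ (Y : Set (ℙ K V)) ⊆ Z

namespace GenLaguerre

variable {K : Type u} {V : Type v} [Field K] [AddCommGroup V] [Module K V] (L : GenLaguerre K V)

open QuadraticMap Submodule

/-! ### The form of the cone and its radical -/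

/-! Everything rests on one relation: two distinct one-dimensional subspaces are adjacent (`Adj`)
when at least two members of `℘₂` contain both. Nothing is adjacent to a cycle: a cycle spans a
plane, any other element enlarges this span to at least a solid, and a member of `℘₂` containing a
cycle is cut out by a solid, which is thereby determined (`not_adj_of_mem_cycles`). By contrast, two
lines through a common point p (possibly in `T`) whose plane is not on the cone are adjacent
(`IsPair.adj`): their plane lies in several affine cones with vertex p if p is in `T`, and in
several Minkowski planes otherwise. Every line belongs to such a pair, so the lines are exactly the
elements that have a neighbour.

Two skew generators of a Minkowski plane span its solid and are not adjacent (`IsHyp.not_adj`),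
whereas distinct lines on a cone over a conic all pass through the vertex and are adjacent
(`adj_of_cone`). The members of `℘₂` containing a cycle are the affine and projective cones and the
Möbius and Minkowski planes. Among these only Minkowski planes carry non-adjacent distinct lines;
their lines miss `T`, and every line missing `T` lies on one. This defines `𝒢`
(`mem_projLines_iff_exists`). Projective cones are then the members that contain a cycle and a
projective line and whose distinct lines are all adjacent (`mem_dClass_iff`): the projective line
excludes affine cones and Möbius planes, adjacency excludes Minkowski planes. -/

lemma coneForm_add_of_mem {x : V} (hx : x ∈ L.T) (y : V) :
    L.coneForm (x + y) = L.coneForm y := by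
  have h : L.B.projectionOnto L.T L.isCompl x = 0 :=
    (Submodule.projectionOnto_apply_eq_zero_iff L.isCompl).2 hx
  simp [coneForm, h]

lemma coneForm_of_mem {x : V} (hx : x ∈ L.T) : L.coneForm x = 0 := by
  simpa using L.coneForm_add_of_mem hx 0

lemma polar_of_mem {x : V} (hx : x ∈ L.T) (y : V) : polar L.coneForm x y = 0 := by
  simp [polar, L.coneForm_add_of_mem hx, L.coneForm_of_mem hx]

lemma not_mem_of_polar {x y : V} (h : polar L.coneForm x y ≠ 0) : x ∉ L.T :=
  fun hx => h (L.polar_of_mem hx y)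

lemma not_mem_of_polar' {x y : V} (h : polar L.coneForm x y ≠ 0) : y ∉ L.T :=
  L.not_mem_of_polar (polar_comm L.coneForm x y ▸ h)

/-- With `polar_of_mem` this makes `T` exactly the kernel of the polar form: a vector orthogonal to
everything has its `B`-component in the radical of the base form. -/
lemma exists_polar_ne (h2 : (2 : K) ≠ 0) {x : V} (hx : x ∉ L.T) :
    ∃ y, polar L.coneForm x y ≠ 0 := by
  by_contra! h
  have : Invertible (2 : K) := invertibleOfNonzero h2
  refine hx ((Submodule.projectionOnto_apply_eq_zero_iff L.isCompl).1 ?_)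
  rw [← Submodule.mem_bot K, ← L.nondegenerate.radical_eq_bot, radical_eq_ker_polarBilin,
    LinearMap.mem_ker]
  ext y
  have := h y
  simpa [coneForm, polar, Submodule.projectionOnto_apply_left] using this

lemma polar_self_eq_zero {x : V} (hx : L.coneForm x = 0) : polar L.coneForm x x = 0 := by
  simp [polar_self, hx]

lemma Singular.polar_eq_zero {L : GenLaguerre K V} {H : Submodule K V} (hH : L.Singular H)
    {x y : V} (hx : x ∈ H) (hy : y ∈ H) : polar L.coneForm x y = 0 := by
  simp [polar, hH _ (add_mem hx hy), hH x hx, hH y hy]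

lemma nondegenerate_comp_subtype_iff (h2 : (2 : K) ≠ 0) (D : Submodule K V) :
    (L.coneForm.comp D.subtype).Nondegenerate ↔
      ∀ x ∈ D, (∀ y ∈ D, polar L.coneForm x y = 0) → x = 0 := by
  have : Invertible (2 : K) := invertibleOfNonzero h2
  rw [nondegenerate_iff_radical_eq_bot, radical_eq_ker_polarBilin, eq_bot_iff]
  have hp : ∀ x y : D, polar (L.coneForm.comp D.subtype) x y = polar L.coneForm x y :=
    fun x y => rfl
  constructor
  · intro h x hx hxy
    have := @h ⟨x, hx⟩ (by
      rw [LinearMap.mem_ker]; ext y; simpa [hp] using hxy y y.2)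
    simpa using this
  · intro h x hx
    rw [Submodule.mem_bot]
    refine Subtype.ext (h x x.2 fun y hy => ?_)
    have := LinearMap.congr_fun (LinearMap.mem_ker.1 hx) ⟨y, hy⟩
    simpa [hp] using this

/-- A totally singular subspace lies in its own orthogonal, whose dimension is complementary since
the polar form on `D` has trivial kernel. -/
lemma two_mul_finrank_le [FiniteDimensional K V] {D U : Submodule K V}
    (hD : ∀ x ∈ D, (∀ y ∈ D, polar L.coneForm x y = 0) → x = 0) (hUD : U ≤ D)
    (hU : L.Singular U) : 2 * finrank K U ≤ finrank K D := by
  let β : LinearMap.BilinForm K D := (L.coneForm.comp D.subtype).polarBilin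
  have hβ : ∀ x y : D, β x y = polar L.coneForm x y := fun x y => rfl
  have h := LinearMap.BilinForm.finrank_add_finrank_orthogonal' (B := β) (U.comap D.subtype)
  have hker : LinearMap.ker β = ⊥ := by
    rw [eq_bot_iff]
    intro x hx
    rw [Submodule.mem_bot]
    refine Subtype.ext (hD x x.2 fun y hy => ?_)
    rw [← hβ x ⟨y, hy⟩, LinearMap.mem_ker.1 hx, LinearMap.zero_apply]
  have hle : U.comap D.subtype ≤ β.orthogonal (U.comap D.subtype) := by
    intro x hx y hy
    exact hU.polar_eq_zero hy hx
  have h1 := Submodule.finrank_mono hle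
  rw [hker, inf_bot_eq, finrank_bot, add_zero] at h
  have h3 : finrank K (U.comap D.subtype) = finrank K U :=
    (Submodule.comapSubtypeEquivOfLe hUD).finrank_eq
  omega

/-! ### Hyperbolic pairs -/

/-- Subtracting a multiple of `a` from `x` makes it singular, rescaling normalises the pairing. The
last clause says that `b` is in the span of `a` and `x`, so the construction can be confined to a
given subspace. -/
lemma exists_hyperbolic {a x : V} (ha : L.coneForm a = 0) (hx : polar L.coneForm a x ≠ 0) :
    ∃ b, L.coneForm b = 0 ∧ polar L.coneForm a b = 1 ∧
      ∀ H : Submodule K V, a ∈ H → x ∈ H → b ∈ H := by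
  set k := polar L.coneForm a x with hk
  refine ⟨k⁻¹ • (x - (L.coneForm x * k⁻¹) • a), ?_, ?_, fun H h1 h2 =>
    H.smul_mem _ (H.sub_mem h2 (H.smul_mem _ h1))⟩
  · have : L.coneForm (x - (L.coneForm x * k⁻¹) • a) = 0 := by
      rw [sub_eq_add_neg, ← neg_smul, QuadraticMap.map_add L.coneForm, polar_smul_right,
        polar_comm, ← hk,
        QuadraticMap.map_smul, ha]
      simp [hx]
    rw [QuadraticMap.map_smul, this, smul_zero]
  · rw [polar_smul_right, polar_sub_right, polar_smul_right, L.polar_self_eq_zero ha, ← hk]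
    simp [hx]

/-- `p`, `a`, `b` span a degenerate hyperbolic plane with radical `p`. -/
structure IsPair (p a b : V) : Prop where
  p_ne : p ≠ 0
  zp : L.coneForm p = 0
  za : L.coneForm a = 0
  zb : L.coneForm b = 0
  pa : polar L.coneForm p a = 0
  pb : polar L.coneForm p b = 0
  ab : polar L.coneForm a b = 1

/-- `p`, `d` and `a`, `b` are orthogonal hyperbolic pairs. -/
structure IsHyp (p d a b : V) : Prop extends L.IsPair p a b where
  zd : L.coneForm d = 0
  pd : polar L.coneForm p d = 1
  da : polar L.coneForm d a = 0
  db : polar L.coneForm d b = 0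

/-- `x` is a non-singular vector orthogonal to a hyperbolic pair `a`, `b`. -/
structure IsConic (a b x : V) : Prop where
  za : L.coneForm a = 0
  zb : L.coneForm b = 0
  ab : polar L.coneForm a b = 1
  xa : polar L.coneForm x a = 0
  xb : polar L.coneForm x b = 0
  ne : L.coneForm x ≠ 0

variable {L}

/-- Gram–Schmidt: the components of `x` along `a` and `b` are removed, then a multiple of `p` makes
the vector singular. Modulo `p`, `a`, `b` the result is a nonzero multiple of `x`, so `d` can be
kept inside a given `H` or forced out of it. -/
lemma IsPair.exists_hyp {p a b x : V} (h : L.IsPair p a b) (hx : polar L.coneForm p x ≠ 0) :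
    ∃ d, L.IsHyp p d a b ∧ ∀ H : Submodule K V, p ∈ H → a ∈ H → b ∈ H → (d ∈ H ↔ x ∈ H) := by
  set k := polar L.coneForm p x with hk
  obtain ⟨y, hy⟩ : ∃ y, y = x - polar L.coneForm x b • a - polar L.coneForm x a • b := ⟨_, rfl⟩
  have hba : polar L.coneForm b a = 1 := by rw [polar_comm, h.ab]
  have hpy : polar L.coneForm p y = k := by
    simp [hy, polar_sub_right, polar_smul_right, h.pa, h.pb, hk]
  have hya : polar L.coneForm y a = 0 := by
    simp [hy, polar_sub_left, polar_smul_left, L.polar_self_eq_zero h.za, hba]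
  have hyb : polar L.coneForm y b = 0 := by
    simp [hy, polar_sub_left, polar_smul_left, L.polar_self_eq_zero h.zb, h.ab]
  set z := y - (L.coneForm y * k⁻¹) • p with hz
  have hQz : L.coneForm z = 0 := by
    rw [hz, sub_eq_add_neg, ← neg_smul, QuadraticMap.map_add L.coneForm, polar_smul_right,
      polar_comm, hpy,
      QuadraticMap.map_smul, h.zp]
    simp [hx]
  refine ⟨k⁻¹ • z, ⟨h, ?_, ?_, ?_, ?_⟩, fun H hp ha hb => ?_⟩
  · rw [QuadraticMap.map_smul, hQz, smul_zero]
  · rw [polar_smul_right, hz, polar_sub_right, polar_smul_right, L.polar_self_eq_zero h.zp, hpy]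
    simp [hx]
  · simp [polar_smul_left, hz, polar_sub_left, hya, h.pa]
  · simp [polar_smul_left, hz, polar_sub_left, hyb, h.pb]
  · rw [H.smul_mem_iff (inv_ne_zero hx), hz, H.sub_mem_iff_left (H.smul_mem _ hp), hy,
      H.sub_mem_iff_left (H.smul_mem _ hb), H.sub_mem_iff_left (H.smul_mem _ ha)]

/-- The form takes the value `c` at `p + c • d`; different `c` give different conics through the
same pair. -/
lemma IsHyp.isConic {p d a b : V} (h : L.IsHyp p d a b) {c : K} (hc : c ≠ 0) :
    L.IsConic a b (p + c • d) where
  za := h.za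
  zb := h.zb
  ab := h.ab
  xa := by simp [polar_add_left, polar_smul_left, h.pa, h.da]
  xb := by simp [polar_add_left, polar_smul_left, h.pb, h.db]
  ne := by simp [QuadraticMap.map_add L.coneForm, QuadraticMap.map_smul, polar_smul_right, h.zp,
    h.zd, h.pd, hc]

lemma IsHyp.linearIndependent {p d a b : V} (h : L.IsHyp p d a b) :
    LinearIndependent K ![p, d, a, b] := by
  rw [Fintype.linearIndependent_iff]
  intro g hg
  simp only [Fin.sum_univ_four, Matrix.cons_val] at hg
  have key : ∀ y, g 0 * polar L.coneForm p y + g 1 * polar L.coneForm d y +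
      g 2 * polar L.coneForm a y + g 3 * polar L.coneForm b y = 0 := by
    intro y
    have := congrArg (fun x => polar L.coneForm x y) hg
    simpa [polar_add_left, polar_smul_left, polar_zero_left] using this
  have h0 := key d
  have h1 := key p
  have h2 := key b
  have h3 := key a
  simp only [polar_comm L.coneForm d p, polar_comm L.coneForm a p, polar_comm L.coneForm b p,
    polar_comm L.coneForm b a, h.pd, h.pa, h.pb, h.da, h.db, h.ab,
    L.polar_self_eq_zero, h.zp, h.zd, h.za, h.zb, polar_comm L.coneForm b d,
      polar_comm L.coneForm a d] at h0 h1 h2 h3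
  simp at h0 h1 h2 h3
  intro i
  fin_cases i <;> assumption

/-- Pairing a relation with `b`, `a`, `x` isolates its coefficients; the pairing of `x` with itself
is twice its form value, hence the assumption on 2. -/
lemma IsConic.linearIndependent (h2 : (2 : K) ≠ 0) {a b x : V} (h : L.IsConic a b x) :
    LinearIndependent K ![a, b, x] := by
  rw [Fintype.linearIndependent_iff]
  intro g hg
  simp only [Fin.sum_univ_three, Matrix.cons_val] at hg
  have key : ∀ y, g 0 * polar L.coneForm a y + g 1 * polar L.coneForm b y +
      g 2 * polar L.coneForm x y = 0 := by
    intro y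
    have := congrArg (fun x => polar L.coneForm x y) hg
    simpa [polar_add_left, polar_smul_left, polar_zero_left] using this
  have h0 := key b
  have h1 := key a
  have h3 := key x
  simp only [polar_comm L.coneForm b a, polar_comm L.coneForm a x, polar_comm L.coneForm b x,
    h.xa, h.xb, h.ab,
    L.polar_self_eq_zero, h.za, h.zb, polar_self] at h0 h1 h3
  simp [h2, h.ne] at h0 h1 h3
  intro i
  fin_cases i <;> assumption

lemma IsHyp.eq_zero {p d a b : V} (h : L.IsHyp p d a b) {x : V}
    (hx : x ∈ span K (Set.range ![p, d, a, b]))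
    (hp : polar L.coneForm x p = 0) (hd : polar L.coneForm x d = 0)
    (ha : polar L.coneForm x a = 0) (hb : polar L.coneForm x b = 0) : x = 0 := by
  obtain ⟨g, rfl⟩ := (Submodule.mem_span_range_iff_exists_fun K).1 hx
  simp only [Fin.sum_univ_four, Matrix.cons_val] at *
  simp only [polar_add_left, polar_smul_left, polar_comm L.coneForm d p,
    polar_comm L.coneForm a p, polar_comm L.coneForm b p, polar_comm L.coneForm b a, h.pd, h.pa,
    h.pb,
    h.da, h.db, h.ab,
    L.polar_self_eq_zero, h.zp, h.zd, h.za, h.zb, polar_comm L.coneForm b d,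
      polar_comm L.coneForm a d] at hp hd ha hb
  simp at hp hd ha hb
  simp [hp, hd, ha, hb]

lemma IsConic.eq_zero (h2 : (2 : K) ≠ 0) {a b x : V} (h : L.IsConic a b x) {y : V}
    (hy : y ∈ span K (Set.range ![a, b, x])) (ha : polar L.coneForm y a = 0)
    (hb : polar L.coneForm y b = 0) (hx : polar L.coneForm y x = 0) : y = 0 := by
  obtain ⟨g, rfl⟩ := (Submodule.mem_span_range_iff_exists_fun K).1 hy
  simp only [Fin.sum_univ_three, Matrix.cons_val] at *
  simp only [polar_add_left, polar_smul_left, polar_comm L.coneForm b a,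
    polar_comm L.coneForm a x, polar_comm L.coneForm b x,
    h.xa, h.xb, h.ab, L.polar_self_eq_zero, h.za, h.zb, polar_self] at ha hb hx
  simp [h2, h.ne] at ha hb hx
  simp [ha, hb, hx]

end GenLaguerre

namespace GenLaguerre

variable {K : Type u} {V : Type v} [Field K] [AddCommGroup V] [Module K V] {L : GenLaguerre K V}

open QuadraticMap Submodule

/-! ### Sections -/

lemma singular_span_singleton {v : V} (hv : L.coneForm v = 0) : L.Singular (span K {v}) := by
  intro x hx
  obtain ⟨c, rfl⟩ := mem_span_singleton.1 hx
  simp [QuadraticMap.map_smul, hv]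

lemma mk_mem_sect {v : V} (hv : v ≠ 0) {H : Submodule K V} :
    Projectivization.mk K v hv ∈ L.sect H ↔ L.coneForm v = 0 ∧ v ∉ L.T ∧ v ∈ H := by
  simp only [sect, S, S₀, pts, Set.mem_inter_iff, Set.mem_sdiff, Set.mem_ofPred_eq,
    Projectivization.submodule_mk, span_singleton_le_iff_mem, and_assoc]
  exact and_congr_left' ⟨fun h => h v (mem_span_singleton_self v), singular_span_singleton⟩

lemma sect_subset_sect_iff {H H' : Submodule K V} :
    L.sect H ⊆ L.sect H' ↔ ∀ v, L.coneForm v = 0 → v ∉ L.T → v ∈ H → v ∈ H' := by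
  constructor
  · intro h v hv hT hH
    have hv0 : v ≠ 0 := fun h0 => hT (h0 ▸ zero_mem _)
    exact ((mk_mem_sect hv0).1 (h ((mk_mem_sect hv0).2 ⟨hv, hT, hH⟩))).2.2
  · intro h q
    induction q using Projectivization.ind with
    | h v hv =>
      rw [mk_mem_sect, mk_mem_sect]
      exact fun ⟨h1, h2, h3⟩ => ⟨h1, h2, h v h1 h2 h3⟩

lemma sect_mono {H H' : Submodule K V} (h : H ≤ H') : L.sect H ⊆ L.sect H' :=
  sect_subset_sect_iff.2 fun _ _ _ hv => h hv

lemma pts_subset_iff {H : Submodule K V} : pts H ⊆ L.S₀ ↔ L.Singular H := by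
  constructor
  · intro h x hx
    by_cases hx0 : x = 0
    · simp [hx0]
    · have : Projectivization.mk K x hx0 ∈ pts H := by simpa [pts] using hx
      have := h this
      simp only [S₀, Set.mem_ofPred_eq, Projectivization.submodule_mk] at this
      exact this x (mem_span_singleton_self x)
  · intro h q hq x hx
    exact h x (hq hx)

lemma sect_nonempty {H : Submodule K V} (hH : L.Singular H) (hT : ¬ H ≤ L.T) :
    (L.sect H).Nonempty := by
  obtain ⟨v, hv, hvT⟩ := SetLike.not_le_iff_exists.1 hT
  have hv0 : v ≠ 0 := fun h0 => hvT (h0 ▸ zero_mem _)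
  exact ⟨_, (mk_mem_sect hv0).2 ⟨hH v hv, hvT, hv⟩⟩

/-- The section omits the points of `T`, but these are recovered as differences: a vector of `T`
plus one outside `T` is outside `T`. -/
lemma Singular.le_of_sect_subset {H H' : Submodule K V} (hH : L.Singular H) (hT : ¬ H ≤ L.T)
    (h : L.sect H ⊆ L.sect H') : H ≤ H' := by
  rw [sect_subset_sect_iff] at h
  obtain ⟨v, hv, hvT⟩ := SetLike.not_le_iff_exists.1 hT
  have key : ∀ x ∈ H, x ∉ L.T → x ∈ H' := fun x hx hxT => h x (hH x hx) hxT hx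
  intro x hx
  by_cases hxT : x ∈ L.T
  · have := key (x + v) (add_mem hx hv) (by rwa [L.T.add_mem_iff_right hxT])
    exact (H'.add_mem_iff_left (key v hv hvT)).1 this
  · exact key x hx hxT

/-- The singular points of `H` span `H` once a singular `e` is not orthogonal to all of `H`: a
vector not orthogonal to `e` becomes singular after subtracting a multiple of `e`, and such vectors
generate `H`. -/
lemma le_of_sect_subset {H H' : Submodule K V} {e f : V} (he : e ∈ H) (hf : f ∈ H)
    (hQe : L.coneForm e = 0) (hef : polar L.coneForm e f ≠ 0)
    (h : L.sect H ⊆ L.sect H') : H ≤ H' := by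
  rw [sect_subset_sect_iff] at h
  have heH : e ∈ H' := h e hQe (L.not_mem_of_polar hef) he
  have key : ∀ y ∈ H, polar L.coneForm e y ≠ 0 → y ∈ H' := by
    intro y hy hey
    have h1 : y - (L.coneForm y / polar L.coneForm e y) • e ∈ H' := by
      refine h _ ?_ (L.not_mem_of_polar' (x := e) ?_) (sub_mem hy (H.smul_mem _ he))
      · rw [sub_eq_add_neg, ← neg_smul, QuadraticMap.map_add L.coneForm, polar_smul_right,
          polar_comm L.coneForm y e, QuadraticMap.map_smul, hQe]
        simp [hey]
      · simpa [polar_sub_right, polar_smul_right, L.polar_self_eq_zero hQe] using hey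
    exact (H'.sub_mem_iff_left (H'.smul_mem _ heH)).1 h1
  intro y hy
  by_cases hey : polar L.coneForm e y = 0
  · have := key (y + f) (add_mem hy hf) (by rwa [polar_add_right, hey, zero_add])
    exact (H'.add_mem_iff_left (key f hf hef)).1 this
  · exact key y hy hey

/-! ### Lines and cycles -/

lemma mem_lines_iff {X : Set (ℙ K V)} : X ∈ L.lines ↔
    ∃ A : Submodule K V, finrank K A = 2 ∧ L.Singular A ∧ ¬ A ≤ L.T ∧ X = L.sect A := by
  constructor
  · rintro ⟨A, hA, hs, rfl, q, hq⟩
    exact ⟨A, hA, pts_subset_iff.1 hs, fun hT => hq.1.2 (hq.2.trans hT), rfl⟩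
  · rintro ⟨A, hA, hs, hT, rfl⟩
    exact ⟨A, hA, pts_subset_iff.2 hs, rfl, sect_nonempty hs hT⟩

lemma not_le_of_inf_eq_bot {A : Submodule K V} (hA : finrank K A = 2) (hT : A ⊓ L.T = ⊥) :
    ¬ A ≤ L.T := by
  intro h
  rw [inf_eq_left.2 h] at hT
  rw [hT, finrank_bot] at hA
  omega

lemma mem_projLines_iff {X : Set (ℙ K V)} : X ∈ L.projLines ↔
    ∃ A : Submodule K V, finrank K A = 2 ∧ L.Singular A ∧ A ⊓ L.T = ⊥ ∧ X = L.sect A := by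
  simp only [projLines, Set.mem_ofPred_eq, pts_subset_iff]

lemma projLines_subset_lines : L.projLines ⊆ L.lines := by
  intro X hX
  obtain ⟨A, hA, hs, hT, rfl⟩ := mem_projLines_iff.1 hX
  exact mem_lines_iff.2 ⟨A, hA, hs, not_le_of_inf_eq_bot hA hT, rfl⟩

lemma singular_span_pair {x y : V} (hx : L.coneForm x = 0) (hy : L.coneForm y = 0)
    (hxy : polar L.coneForm x y = 0) : L.Singular (span K {x, y}) := by
  intro z hz
  obtain ⟨s, t, rfl⟩ := mem_span_pair.1 hz
  simp [QuadraticMap.map_add L.coneForm, QuadraticMap.map_smul, polar_smul_left,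
    polar_smul_right, hx, hy, hxy]

lemma finrank_span_pair_eq_two {x y : V} (hx : x ≠ 0) (hy : y ∉ span K {x}) :
    finrank K (span K {x, y}) = 2 := by
  have h : LinearIndependent K ![x, y] := by
    rw [LinearIndependent.pair_iff' hx]
    exact fun c hc => hy (mem_span_singleton.2 ⟨c, hc⟩)
  have := finrank_span_eq_card h
  rwa [Matrix.range_cons_cons_empty] at this

/-- Two distinct points of a cycle are not orthogonal, since otherwise their join would lie on the
cone and give a line inside the cycle. -/
lemma exists_of_mem_cycles {X : Set (ℙ K V)} (hX : X ∈ L.cycles) :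
    ∃ A : Submodule K V, finrank K A = 3 ∧
      (∃ e ∈ A, ∃ f ∈ A, L.coneForm e = 0 ∧ polar L.coneForm e f ≠ 0) ∧
      (∀ U ≤ A, finrank K U = 2 → L.Singular U → U ≤ L.T) ∧ X = L.sect A := by
  obtain ⟨A, hA, rfl, ⟨q, hq, r, hr, hqr⟩, hl⟩ := hX
  have hno : ∀ U ≤ A, finrank K U = 2 → L.Singular U → U ≤ L.T := by
    intro U hU h2 hs
    by_contra hT
    exact hl _ (mem_lines_iff.2 ⟨U, h2, hs, hT, rfl⟩) (sect_mono hU)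
  refine ⟨A, hA, ?_, hno, rfl⟩
  induction q using Projectivization.ind with
  | h e he =>
  induction r using Projectivization.ind with
  | h f hf =>
  rw [mk_mem_sect] at hq hr
  refine ⟨e, hq.2.2, f, hr.2.2, hq.1, fun h0 => hq.2.1 ?_⟩
  refine hno (span K {e, f}) ?_ (finrank_span_pair_eq_two he fun h => hqr ?_)
    (singular_span_pair hq.1 hr.1 h0) (subset_span (by simp))
  · rw [span_le]
    rintro x (rfl | rfl)
    exacts [hq.2.2, hr.2.2]
  · obtain ⟨c, hc⟩ := mem_span_singleton.1 h
    exact ((Projectivization.mk_eq_mk_iff' K f e hf he).2 ⟨c, hc⟩).symm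

lemma IsQuadric.mem_cycles (h2 : (2 : K) ≠ 0) {D : Submodule K V} (hD : L.IsQuadric 1 0 D) :
    L.sect D ∈ L.cycles := by
  obtain ⟨h3, hn, ⟨U, hUD, hU, hU1⟩, hmax⟩ := hD
  rw [nondegenerate_comp_subtype_iff L h2] at hn
  refine ⟨D, h3, rfl, ?_, fun Y hY hYD => ?_⟩
  · obtain ⟨e, he, he0⟩ := U.ne_bot_iff.1 (by rintro rfl; simp at hU1)
    obtain ⟨x, hxD, hx⟩ : ∃ x ∈ D, polar L.coneForm e x ≠ 0 := by
      by_contra! h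
      exact he0 (hn e (hUD he) h)
    obtain ⟨f, hf, hef, hfD⟩ := L.exists_hyperbolic (hU e he) hx
    have hef' : polar L.coneForm e f ≠ 0 := by simp [hef]
    have hf0 : f ≠ 0 := fun h => L.not_mem_of_polar' hef' (h ▸ zero_mem _)
    refine ⟨_, (mk_mem_sect he0).2 ⟨hU e he, L.not_mem_of_polar hef', hUD he⟩, _,
      (mk_mem_sect hf0).2 ⟨hf, L.not_mem_of_polar' hef', hfD D (hUD he) hxD⟩, fun h => ?_⟩
    obtain ⟨c, hc⟩ := (Projectivization.mk_eq_mk_iff' K e f he0 hf0).1 h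
    rw [← hc, polar_smul_left, L.polar_self_eq_zero hf, smul_zero] at hef
    exact zero_ne_one hef
  · obtain ⟨A, hA, hs, hT, rfl⟩ := mem_lines_iff.1 hY
    have := hmax ⟨A, hs.le_of_sect_subset hT hYD, hs, hA⟩
    omega

/-! ### Pairs of one-dimensional subspaces in several two-dimensional ones -/

variable (L) in
/-- Two distinct sets are adjacent if they are contained in at least two common members of `℘₂`. -/
def Adj (X Y : Set (ℙ K V)) : Prop :=
  X ≠ Y ∧ ∃ Z ∈ L.sub₂, ∃ Z' ∈ L.sub₂, Z ≠ Z' ∧ X ⊆ Z ∧ Y ⊆ Z ∧ X ⊆ Z' ∧ Y ⊆ Z'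

lemma finrank_sup_eq_add_of_disjoint [FiniteDimensional K V] {W D : Submodule K V} (h : Disjoint W D) :
    finrank K (W ⊔ D : Submodule K V) = finrank K W + finrank K D := by
  have := finrank_sup_add_finrank_inf_eq W D
  rwa [h.eq_bot, finrank_bot, add_zero] at this

/-- The cones and nondegenerate quadrics span solids, that is, vector dimension 4; the generators
come from totally singular planes. -/
lemma exists_of_mem_sub₂ [FiniteDimensional K V] {Z : Set (ℙ K V)} (hZ : Z ∈ L.sub₂) :
    ∃ H : Submodule K V, Z = L.sect H ∧ (finrank K H = 4 ∨ finrank K H = 3 ∧ L.Singular H) := by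
  obtain (((((⟨H, h1, h2, h3, h4, rfl⟩ | ⟨H, h1, h2, h3, h4, rfl⟩) | ⟨H, h1, h2, h3, h4, rfl⟩) |
    ⟨W, D, hd, ⟨h1, -⟩, -, -, h2, rfl⟩) | ⟨W, D, hd, ⟨h1, -⟩, -, -, h2, rfl⟩) |
    ⟨W, D, hd, ⟨h1, -⟩, -, -, h2, rfl⟩) | ⟨W, D, hd, ⟨h1, -⟩, -, -, h2, rfl⟩ := hZ
  · exact ⟨H, rfl, Or.inr ⟨h1, pts_subset_iff.1 h2⟩⟩
  · exact ⟨H, rfl, Or.inr ⟨h1, pts_subset_iff.1 h2⟩⟩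
  · exact ⟨H, rfl, Or.inr ⟨h1, pts_subset_iff.1 h2⟩⟩
  all_goals
    refine ⟨_, rfl, Or.inl ?_⟩
    rw [finrank_sup_eq_add_of_disjoint hd]
    omega

lemma not_adj_of_mem_cycles [FiniteDimensional K V] {X Y : Set (ℙ K V)} (hX : X ∈ L.cycles)
    (hY : Y ∈ L.sub₁) : ¬ L.Adj X Y := by
  rintro ⟨hne, Z, hZ, Z', hZ', hZZ, hXZ, hYZ, hXZ', hYZ'⟩
  obtain ⟨A, hA, ⟨e, he, f, hf, hQe, hef⟩, hno, rfl⟩ := exists_of_mem_cycles hX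
  -- `A'` is the span of `Y`. It is not inside `A`: if `Y` is a cycle it would equal `X`, and if `Y`
  -- is a line it would be a line in a cycle.
  obtain ⟨A', hA', hle⟩ : ∃ A' : Submodule K V, ¬ A' ≤ A ∧
      ∀ H, Y ⊆ L.sect H → A' ≤ H := by
    rcases hY with hY | hY
    · obtain ⟨A', hA', ⟨e', he', f', hf', hQe', hef'⟩, -, rfl⟩ := exists_of_mem_cycles hY
      refine ⟨A', fun h => hne ?_, fun H hH => le_of_sect_subset he' hf' hQe' hef' hH⟩
      rw [eq_of_le_of_finrank_eq h (hA'.trans hA.symm)]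
    · obtain ⟨A', hA', hs, hT, rfl⟩ := mem_lines_iff.1 hY
      exact ⟨A', fun h => hT (hno A' h hA' hs), fun H hH => hs.le_of_sect_subset hT hH⟩
  have key : ∀ Z ∈ L.sub₂, L.sect A ⊆ Z → Y ⊆ Z → Z = L.sect (A ⊔ A') := by
    intro Z hZ h1 h2
    obtain ⟨H, rfl, hH⟩ := exists_of_mem_sub₂ hZ
    have hAH := le_of_sect_subset he hf hQe hef h1
    have hlt : A < A ⊔ A' := left_lt_sup.2 hA'
    have := finrank_lt_finrank_of_lt hlt
    rcases hH with hH | ⟨-, hH⟩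
    · rw [eq_of_le_of_finrank_le (sup_le hAH (hle H h2)) (by omega)]
    · exact absurd (hH.polar_eq_zero (hAH he) (hAH hf)) hef
  exact hZZ ((key Z hZ hXZ hYZ).trans (key Z' hZ' hXZ' hYZ').symm)

/-! ### Minkowski planes and affine cones from vectors -/

lemma IsPair.swap {p a b : V} (h : L.IsPair p a b) : L.IsPair p b a :=
  ⟨h.p_ne, h.zp, h.zb, h.za, h.pb, h.pa, by rw [polar_comm, h.ab]⟩

lemma IsPair.finrank_span {p a b : V} (h : L.IsPair p a b) : finrank K (span K {p, a}) = 2 := by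
  refine finrank_span_pair_eq_two h.p_ne fun hm => ?_
  obtain ⟨c, rfl⟩ := mem_span_singleton.1 hm
  have := h.ab
  rw [polar_smul_left, h.pb, smul_zero] at this
  exact zero_ne_one this

lemma IsPair.singular {p a b : V} (h : L.IsPair p a b) : L.Singular (span K {p, a}) :=
  singular_span_pair h.zp h.za h.pa

lemma IsPair.not_le {p a b : V} (h : L.IsPair p a b) : ¬ span K {p, a} ≤ L.T := fun hT =>
  L.not_mem_of_polar (x := a) (y := b) (by simp [h.ab]) (hT (subset_span (by simp)))

lemma IsPair.mem_lines {p a b : V} (h : L.IsPair p a b) : L.sect (span K {p, a}) ∈ L.lines :=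
  mem_lines_iff.2 ⟨_, h.finrank_span, h.singular, h.not_le, rfl⟩

lemma IsHyp.symm {p d a b : V} (h : L.IsHyp p d a b) : L.IsHyp d p b a where
  p_ne := fun h0 => L.not_mem_of_polar' (x := p) (y := d) (by simp [h.pd]) (h0 ▸ zero_mem _)
  zp := h.zd
  za := h.zb
  zb := h.za
  pa := h.db
  pb := h.da
  ab := by rw [polar_comm, h.ab]
  zd := h.zp
  pd := by rw [polar_comm, h.pd]
  da := h.pb
  db := h.pa

lemma IsHyp.isQuadric [FiniteDimensional K V] (h2 : (2 : K) ≠ 0) {p d a b : V}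
    (h : L.IsHyp p d a b) : L.IsQuadric 2 1 (span K (Set.range ![p, d, a, b])) := by
  have hm : ∀ i, ![p, d, a, b] i ∈ span K (Set.range ![p, d, a, b]) :=
    fun i => subset_span ⟨i, rfl⟩
  have h4 : finrank K (span K (Set.range ![p, d, a, b])) = 4 :=
    finrank_span_eq_card h.linearIndependent
  have hn : ∀ x ∈ span K (Set.range ![p, d, a, b]),
      (∀ y ∈ span K (Set.range ![p, d, a, b]), polar L.coneForm x y = 0) → x = 0 :=
    fun x hx hxy => h.eq_zero hx (hxy _ (hm 0)) (hxy _ (hm 1)) (hxy _ (hm 2)) (hxy _ (hm 3))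
  refine ⟨h4, (L.nondegenerate_comp_subtype_iff h2 _).2 hn,
    ⟨span K {p, a}, ?_, h.singular, h.finrank_span⟩, ?_⟩
  · rw [span_le]
    rintro x (rfl | rfl)
    exacts [hm 0, hm 2]
  · rintro k ⟨U, hU, hs, rfl⟩
    have := L.two_mul_finrank_le hn hU hs
    omega

lemma IsConic.isQuadric [FiniteDimensional K V] (h2 : (2 : K) ≠ 0) {a b x : V}
    (h : L.IsConic a b x) : L.IsQuadric 1 0 (span K (Set.range ![a, b, x])) := by
  have hm : ∀ i, ![a, b, x] i ∈ span K (Set.range ![a, b, x]) :=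
    fun i => subset_span ⟨i, rfl⟩
  have h3 : finrank K (span K (Set.range ![a, b, x])) = 3 :=
    finrank_span_eq_card (h.linearIndependent h2)
  have hn : ∀ y ∈ span K (Set.range ![a, b, x]),
      (∀ z ∈ span K (Set.range ![a, b, x]), polar L.coneForm y z = 0) → y = 0 :=
    fun y hy hyz => h.eq_zero h2 hy (hyz _ (hm 0)) (hyz _ (hm 1)) (hyz _ (hm 2))
  have ha0 : a ≠ 0 := (h.linearIndependent h2).ne_zero 0
  refine ⟨h3, (L.nondegenerate_comp_subtype_iff h2 _).2 hn,
    ⟨span K {a}, ?_, singular_span_singleton h.za, finrank_span_singleton ha0⟩, ?_⟩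
  · rw [span_singleton_le_iff_mem]
    exact hm 0
  · rintro k ⟨U, hU, hs, rfl⟩
    have := L.two_mul_finrank_le hn hU hs
    omega

lemma IsHyp.mem_sub₂ [FiniteDimensional K V] (h2 : (2 : K) ≠ 0) {p d a b : V}
    (h : L.IsHyp p d a b) : L.sect (span K (Set.range ![p, d, a, b])) ∈ L.sub₂ := by
  refine Or.inr ⟨⊥, _, disjoint_bot_left, h.isQuadric h2, ?_, ?_, ?_, by rw [bot_sup_eq]⟩
  · simp
  · rw [bot_inf_eq, finrank_bot]
  · rw [finrank_bot]

lemma IsConic.mem_sub₂ [FiniteDimensional K V] (h2 : (2 : K) ≠ 0) {p a b x : V}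
    (h : L.IsConic a b x) (hp : p ∈ L.T) (hp0 : p ≠ 0) :
    L.sect (span K {p} ⊔ span K (Set.range ![a, b, x])) ∈ L.sub₂ := by
  have hpT : span K {p} ≤ L.T := by rwa [span_singleton_le_iff_mem]
  refine Or.inl (Or.inl (Or.inl (Or.inr ⟨span K {p}, _, ?_, h.isQuadric h2, ?_, ?_, ?_, rfl⟩)))
  · rw [disjoint_def]
    intro y hy hy'
    exact h.eq_zero h2 hy' (L.polar_of_mem (hpT hy) _) (L.polar_of_mem (hpT hy) _)
      (L.polar_of_mem (hpT hy) _)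
  · exact fun y hy z _ => L.coneForm_add_of_mem (hpT hy) z
  · rw [inf_eq_left.2 hpT, finrank_span_singleton hp0]
  · rw [finrank_span_singleton hp0]

/-! ### Existence of hyperbolic bases -/

lemma exists_ne_zero_polar_eq_zero [FiniteDimensional K V] {U : Submodule K V}
    (hU : 1 < finrank K U) (a : V) : ∃ u ∈ U, u ≠ 0 ∧ polar L.coneForm u a = 0 := by
  have h := LinearMap.ker_ne_bot_of_finrank_lt (f := (L.coneForm.polarBilin a) ∘ₗ U.subtype)
    (by simpa using hU)
  obtain ⟨u, hu, hu0⟩ := (Submodule.ne_bot_iff _).1 h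
  refine ⟨u, u.2, by simpa using hu0, ?_⟩
  rw [polar_comm]
  simpa using hu

variable (L) in
lemma exists_singular [FiniteDimensional K V] :
    ∃ U : Submodule K V, finrank K U = 2 ∧ L.Singular U ∧ U ⊓ L.T = ⊥ := by
  obtain ⟨U, hU, hs⟩ := L.ruled
  refine ⟨U.map L.B.subtype, ?_, ?_, ?_⟩
  · rw [finrank_map_subtype_eq, hU]
  · rintro _ ⟨x, hx, rfl⟩
    simpa [coneForm, Submodule.projectionOnto_apply_left] using hs x hx
  · rw [eq_bot_iff, ← L.isCompl.inf_eq_bot]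
    exact inf_le_inf_right _ (map_subtype_le _ _)

/-- Ruledness of the base quadric enters here: a singular `U` missing `T` contains some `u`
orthogonal to `a` and some `w` orthogonal to `b`. Correcting `u` by a multiple of `a`, or `w` by a
multiple of `b`, gives a singular vector orthogonal to both. -/
lemma exists_isHyp_of_polar_eq_one [FiniteDimensional K V] (h2 : (2 : K) ≠ 0) {a b : V}
    (ha : L.coneForm a = 0) (hb : L.coneForm b = 0) (hab : polar L.coneForm a b = 1) :
    ∃ c d, L.IsHyp c d a b := by
  suffices h : ∃ c, c ∉ L.T ∧ L.IsPair c a b by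
    obtain ⟨c, hc, h⟩ := h
    obtain ⟨x, hx⟩ := L.exists_polar_ne h2 hc
    obtain ⟨d, hd, -⟩ := h.exists_hyp hx
    exact ⟨c, d, hd⟩
  obtain ⟨U, hU, hs, hT⟩ := L.exists_singular
  have step : ∀ a b u : V, L.coneForm a = 0 → L.coneForm b = 0 → polar L.coneForm a b = 1 →
      u ∈ U → u ≠ 0 → polar L.coneForm u a = 0 → u - polar L.coneForm u b • a ∉ L.T →
      L.IsPair (u - polar L.coneForm u b • a) a b := by
    intro a b u ha hb hab hu hu0 hua hcT
    refine ⟨fun h => hcT (h ▸ zero_mem _), ?_, ha, hb, ?_, ?_, hab⟩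
    · rw [sub_eq_add_neg, ← neg_smul, QuadraticMap.map_add L.coneForm, polar_smul_right, hua,
        QuadraticMap.map_smul, ha, hs u hu]
      simp
    · simp [polar_sub_left, polar_smul_left, hua, L.polar_self_eq_zero ha]
    · simp [polar_sub_left, polar_smul_left, hab]
  obtain ⟨u, hu, hu0, hua⟩ := exists_ne_zero_polar_eq_zero (L := L) (by omega : 1 < finrank K U) a
  obtain ⟨w, hw, hw0, hwb⟩ := exists_ne_zero_polar_eq_zero (L := L) (by omega : 1 < finrank K U) b
  have hba : polar L.coneForm b a = 1 := by rw [polar_comm, hab]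
  by_cases h1 : u - polar L.coneForm u b • a ∈ L.T
  swap
  · exact ⟨_, h1, step a b u ha hb hab hu hu0 hua h1⟩
  by_cases h3 : w - polar L.coneForm w a • b ∈ L.T
  swap
  · exact ⟨_, h3, (step b a w hb ha hba hw hw0 hwb h3).swap⟩
  -- If both corrected vectors are in `T`, pairing the first with `w` forces `w` to be orthogonal to
  -- `a`; then `w` needs no correction and lies in `T`.
  exfalso
  have hnT : ∀ x ∈ U, x ≠ 0 → x ∉ L.T := fun x hx hx0 hxT =>
    hx0 ((mem_bot K).1 (hT ▸ ⟨hx, hxT⟩))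
  have e1 : polar L.coneForm u b ≠ 0 := fun h => hnT u hu hu0 (by simpa [h] using h1)
  have e2 := L.polar_of_mem h1 w
  have e3 := L.polar_of_mem h3 a
  rw [polar_sub_left, hs.polar_eq_zero hu hw, polar_smul_left, zero_sub, neg_eq_zero,
    smul_eq_mul, polar_comm L.coneForm a w] at e2
  have e4 : polar L.coneForm w a = 0 := (mul_eq_zero.1 e2).resolve_left e1
  exact hnT w hw hw0 (by simpa [e4] using h3)

lemma IsPair.adj [FiniteDimensional K V] (h2 : (2 : K) ≠ 0)
    (hL : L.T ≠ ⊥ ∨ 5 ≤ finrank K L.B) {p a b : V} (h : L.IsPair p a b) :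
    L.Adj (L.sect (span K {p, a})) (L.sect (span K {p, b})) := by
  have hab : polar L.coneForm a b ≠ 0 := by simp [h.ab]
  suffices hs : ∃ H H' : Submodule K V, L.sect H ∈ L.sub₂ ∧ L.sect H' ∈ L.sub₂ ∧ ¬ H ≤ H' ∧
      (p ∈ H ∧ a ∈ H ∧ b ∈ H) ∧ (p ∈ H' ∧ a ∈ H' ∧ b ∈ H') by
    obtain ⟨H, H', h1, h3, h4, ⟨hp, ha, hb⟩, hp', ha', hb'⟩ := hs
    refine ⟨fun he => ?_, _, h1, _, h3, fun he => h4 ?_, ?_, ?_, ?_, ?_⟩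
    · have := h.singular.le_of_sect_subset h.not_le he.subset
      have ha : a ∈ span K {p, b} := this (subset_span (by simp))
      exact hab (h.swap.singular.polar_eq_zero ha (subset_span (by simp)))
    · exact le_of_sect_subset ha hb h.za hab he.subset
    all_goals
      refine sect_mono (span_le.2 ?_)
      rintro x (rfl | rfl) <;> assumption
  by_cases hp : p ∈ L.T
  · obtain ⟨c, d, hcd⟩ := exists_isHyp_of_polar_eq_one h2 h.za h.zb h.ab
    -- The two cones have vertex `p` over the conics given by `c + d` and `c - d`. Were their solids
    -- equal, pairing with `c` and `d` would yield 1 = -1.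
    have hc1 := hcd.isConic one_ne_zero
    have hc2 := hcd.isConic (neg_ne_zero.2 (one_ne_zero (α := K)))
    refine ⟨_, _, hc1.mem_sub₂ h2 hp h.p_ne, hc2.mem_sub₂ h2 hp h.p_ne, fun hle => ?_, ?_, ?_⟩
    · have hm : c + (1 : K) • d ∈ span K {p} ⊔ span K (Set.range ![a, b, c + (-1 : K) • d]) :=
        hle (mem_sup_right (subset_span ⟨2, rfl⟩))
      obtain ⟨y, hy, z, hz, hyz⟩ := mem_sup.1 hm
      obtain ⟨s, rfl⟩ := mem_span_singleton.1 hy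
      obtain ⟨g, rfl⟩ := (Submodule.mem_span_range_iff_exists_fun K).1 hz
      simp only [Fin.sum_univ_three, Matrix.cons_val] at hyz
      have key := fun y => congrArg (fun x => polar L.coneForm x y) hyz
      have k1 := key c
      have k2 := key d
      simp [polar_add_left, polar_smul_left, L.polar_of_mem hp, polar_comm L.coneForm a c,
        polar_comm L.coneForm b c, polar_comm L.coneForm a d, polar_comm L.coneForm b d,
        polar_comm L.coneForm d c, hcd.pa, hcd.pb, hcd.da, hcd.db, hcd.pd, hcd.zp, hcd.zd,
        -neg_smul, -one_smul] at k1 k2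
      exact h2 (by linear_combination -k1 - k2)
    all_goals
      exact ⟨mem_sup_left (mem_span_singleton_self p), mem_sup_right (subset_span ⟨0, rfl⟩),
        mem_sup_right (subset_span ⟨1, rfl⟩)⟩
  · obtain ⟨x, hx⟩ := L.exists_polar_ne h2 hp
    obtain ⟨d, hd, -⟩ := h.exists_hyp hx
    set H := span K (Set.range ![p, d, a, b]) with hH
    have hm : ∀ i, ![p, d, a, b] i ∈ H := fun i => subset_span ⟨i, rfl⟩
    have h4 : finrank K H = 4 := finrank_span_eq_card hd.linearIndependent
    -- The solid `H` is nondegenerate, so if it were everything, `T` would be trivial and `B` would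
    -- have vector dimension at most 4.
    have htop : H ≠ ⊤ := by
      intro ht
      have hT : L.T = ⊥ := by
        rw [eq_bot_iff]
        intro y hy
        exact hd.eq_zero (by rw [← hH, ht]; trivial) (L.polar_of_mem hy _) (L.polar_of_mem hy _)
          (L.polar_of_mem hy _) (L.polar_of_mem hy _)
      have hB := hL.resolve_left (not_not.2 hT)
      have := Submodule.finrank_le L.B
      rw [ht, finrank_top] at h4
      omega
    -- A vector outside `H` not orthogonal to `p` yields a partner of `p` outside `H`, hence a
    -- second Minkowski plane.
    obtain ⟨z, hz, hzH⟩ : ∃ z, polar L.coneForm p z ≠ 0 ∧ z ∉ H := by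
      obtain ⟨z, -, hz⟩ := SetLike.exists_of_lt (lt_top_iff_ne_top.2 htop)
      by_cases hpz : polar L.coneForm p z = 0
      · exact ⟨z + d, by simp [polar_add_right, hpz, hd.pd], 
          fun h' => hz ((H.add_mem_iff_left (hm 1)).1 h')⟩
      · exact ⟨z, hpz, hz⟩
    obtain ⟨d', hd', hiff⟩ := h.exists_hyp hz
    refine ⟨_, H, hd'.mem_sub₂ h2, hd.mem_sub₂ h2, fun hle => ?_,
      ⟨subset_span ⟨0, rfl⟩, subset_span ⟨2, rfl⟩, subset_span ⟨3, rfl⟩⟩, hm 0, hm 2, hm 3⟩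
    exact hzH ((hiff H (hm 0) (hm 2) (hm 3)).1 (hle (subset_span ⟨1, rfl⟩)))

lemma IsHyp.not_adj [FiniteDimensional K V] {p d a b : V} (h : L.IsHyp p d a b) :
    ¬ L.Adj (L.sect (span K {p, a})) (L.sect (span K {d, b})) := by
  rintro ⟨-, Z, hZ, Z', hZ', hne, h1, h3, h4, h5⟩
  have key : ∀ Z ∈ L.sub₂, L.sect (span K {p, a}) ⊆ Z → L.sect (span K {d, b}) ⊆ Z →
      Z = L.sect (span K (Set.range ![p, d, a, b])) := by
    intro Z hZ h1 h3
    obtain ⟨H, rfl, hH⟩ := exists_of_mem_sub₂ hZ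
    have hl1 := h.singular.le_of_sect_subset h.not_le h1
    have hl2 := h.symm.singular.le_of_sect_subset h.symm.not_le h3
    have hle : span K (Set.range ![p, d, a, b]) ≤ H := by
      rw [span_le]
      rintro _ ⟨i, rfl⟩
      fin_cases i
      exacts [hl1 (subset_span (by simp)), hl2 (subset_span (by simp)),
        hl1 (subset_span (by simp)), hl2 (subset_span (by simp))]
    have h4 : finrank K (span K (Set.range ![p, d, a, b])) = 4 :=
      finrank_span_eq_card h.linearIndependent
    rw [eq_of_le_of_finrank_le hle (by omega)]
  exact hne ((key Z hZ h1 h3).trans (key Z' hZ' h4 h5).symm)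

lemma exists_isPair_span_eq [FiniteDimensional K V] (h2 : (2 : K) ≠ 0) {U : Submodule K V}
    (hU : finrank K U = 2) (hs : L.Singular U) (hT : ¬ U ≤ L.T) :
    ∃ p a b, L.IsPair p a b ∧ U = span K {p, a} := by
  obtain ⟨a, ha, haT⟩ := SetLike.not_le_iff_exists.1 hT
  obtain ⟨x, hx⟩ := L.exists_polar_ne h2 haT
  obtain ⟨b, hb, hab, -⟩ := L.exists_hyperbolic (hs a ha) hx
  obtain ⟨p, hp, hp0, hpb⟩ := exists_ne_zero_polar_eq_zero (L := L) (by omega : 1 < finrank K U) b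
  have h : L.IsPair p a b := ⟨hp0, hs p hp, hs a ha, hb, hs.polar_eq_zero hp ha, hpb, hab⟩
  refine ⟨p, a, b, h, (eq_of_le_of_finrank_eq ?_ (h.finrank_span.trans hU.symm)).symm⟩
  rw [span_le]
  rintro y (rfl | rfl) <;> assumption

/-- Since no nonzero vector of `U` is orthogonal to `D`, all partners can be chosen in `D`. It
serves both for projective lines, with `D` the whole space, and for Minkowski planes, with `D`
nondegenerate. -/
lemma exists_isHyp_span_eq [FiniteDimensional K V] {U D : Submodule K V}
    (hU : finrank K U = 2) (hs : L.Singular U) (hUD : U ≤ D)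
    (hD : ∀ x ∈ U, x ≠ 0 → ∃ y ∈ D, polar L.coneForm x y ≠ 0) :
    ∃ p d a b, L.IsHyp p d a b ∧ U = span K {p, a} ∧ span K (Set.range ![p, d, a, b]) ≤ D := by
  obtain ⟨a, ha, ha0⟩ := U.ne_bot_iff.1 (by rintro rfl; simp at hU)
  obtain ⟨x, hxD, hx⟩ := hD a ha ha0
  obtain ⟨b, hb, hab, hbD⟩ := L.exists_hyperbolic (hs a ha) hx
  obtain ⟨p, hp, hp0, hpb⟩ := exists_ne_zero_polar_eq_zero (L := L) (by omega : 1 < finrank K U) b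
  have h : L.IsPair p a b := ⟨hp0, hs p hp, hs a ha, hb, hs.polar_eq_zero hp ha, hpb, hab⟩
  obtain ⟨y, hyD, hy⟩ := hD p hp hp0
  obtain ⟨d, hd, hiff⟩ := h.exists_hyp hy
  have hbD := hbD D (hUD ha) hxD
  refine ⟨p, d, a, b, hd, (eq_of_le_of_finrank_eq ?_ (h.finrank_span.trans hU.symm)).symm, ?_⟩
  · rw [span_le]
    rintro y (rfl | rfl) <;> assumption
  · rw [span_le]
    rintro _ ⟨i, rfl⟩
    fin_cases i
    exacts [hUD hp, (hiff D (hUD hp) (hUD ha) hbD).2 hyD, hUD ha, hbD]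

/-! ### Lines on quadratic cones -/

lemma polar_eq_zero_of_cone {W D : Submodule K V}
    (hW : ∀ x ∈ W, ∀ y ∈ D, L.coneForm (x + y) = L.coneForm y) {w y : V} (hw : w ∈ W)
    (hy : y ∈ D) : polar L.coneForm w y = 0 := by
  have := hW w hw 0 (zero_mem _)
  simp only [add_zero, map_zero] at this
  simp [polar, hW w hw y hy, this]

lemma coneForm_add_of_cone {W D : Submodule K V}
    (hW : ∀ x ∈ W, ∀ y ∈ D, L.coneForm (x + y) = L.coneForm y) {w x : V} (hw : w ∈ W)
    (hx : x ∈ W ⊔ D) : L.coneForm (w + x) = L.coneForm x := by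
  obtain ⟨w', hw', y, hy, rfl⟩ := mem_sup.1 hx
  rw [← add_assoc, hW _ (add_mem hw hw') y hy, hW w' hw' y hy]

/-- A vector of `T` is orthogonal to everything, so its `D`-component lies in the trivial radical of
`D`. -/
lemma mem_vertex_of_mem_T (h2 : (2 : K) ≠ 0) {W D : Submodule K V}
    (hW : ∀ x ∈ W, ∀ y ∈ D, L.coneForm (x + y) = L.coneForm y)
    (hD : (L.coneForm.comp D.subtype).Nondegenerate) {x : V} (hx : x ∈ W ⊔ D) (hxT : x ∈ L.T) :
    x ∈ W := by
  obtain ⟨w, hw, y, hy, rfl⟩ := mem_sup.1 hx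
  have : y = 0 := (L.nondegenerate_comp_subtype_iff h2 D).1 hD y hy fun z hz => by
    have := L.polar_of_mem hxT z
    rwa [polar_add_left, polar_eq_zero_of_cone hW hw hz, zero_add] at this
  simpa [this] using hw

lemma finrank_le_of_isQuadric [FiniteDimensional K V] {W D M : Submodule K V}
    (hd : Disjoint W D) (hW : finrank K W = 1) (hD : L.IsQuadric 1 0 D) (hs : L.Singular M)
    (hM : M ≤ W ⊔ D) : finrank K M ≤ 2 := by
  have h1 := finrank_sup_add_finrank_inf_eq M D
  have h2 := finrank_mono (sup_le hM (le_sup_right : D ≤ W ⊔ D))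
  have h3 := hD.2.2.2 ⟨M ⊓ D, inf_le_right, fun x hx => hs x hx.1, rfl⟩
  have h4 := hD.1
  rw [finrank_sup_eq_add_of_disjoint hd] at h2
  omega

lemma singular_sup {M N : Submodule K V} (hM : L.Singular M) (hN : L.Singular N)
    (h : ∀ x ∈ M, ∀ y ∈ N, polar L.coneForm x y = 0) : L.Singular (M ⊔ N) := by
  intro z hz
  obtain ⟨x, hx, y, hy, rfl⟩ := mem_sup.1 hz
  simp [QuadraticMap.map_add L.coneForm, hM x hx, hN y hy, h x hx y hy]

/-- Joining the vertex to a generator keeps it singular, and singular subspaces of such a cone have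
vector dimension at most 2. -/
lemma vertex_le [FiniteDimensional K V] {W D U : Submodule K V} (hd : Disjoint W D)
    (hW1 : finrank K W = 1) (hD : L.IsQuadric 1 0 D)
    (hW : ∀ x ∈ W, ∀ y ∈ D, L.coneForm (x + y) = L.coneForm y) (hU : finrank K U = 2)
    (hs : L.Singular U) (hUD : U ≤ W ⊔ D) : W ≤ U := by
  have h : L.Singular (U ⊔ W) := by
    intro z hz
    obtain ⟨x, hx, w, hw, rfl⟩ := mem_sup.1 hz
    rw [add_comm, coneForm_add_of_cone hW hw (hUD hx), hs x hx]
  have := finrank_le_of_isQuadric hd hW1 hD h (sup_le hUD le_sup_left)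
  rw [eq_of_le_of_finrank_le (le_sup_left : U ≤ U ⊔ W) (by omega)]
  exact le_sup_right

lemma adj_of_cone [FiniteDimensional K V] (h2 : (2 : K) ≠ 0)
    (hL : L.T ≠ ⊥ ∨ 5 ≤ finrank K L.B) {W D : Submodule K V} (hd : Disjoint W D)
    (hW1 : finrank K W = 1) (hD : L.IsQuadric 1 0 D)
    (hW : ∀ x ∈ W, ∀ y ∈ D, L.coneForm (x + y) = L.coneForm y) {X Y : Set (ℙ K V)}
    (hX : X ∈ L.lines) (hY : Y ∈ L.lines) (hXD : X ⊆ L.sect (W ⊔ D)) (hYD : Y ⊆ L.sect (W ⊔ D))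
    (hXY : X ≠ Y) : L.Adj X Y := by
  obtain ⟨M, hM, hMs, hMT, rfl⟩ := mem_lines_iff.1 hX
  obtain ⟨N, hN, hNs, hNT, rfl⟩ := mem_lines_iff.1 hY
  have hMD := hMs.le_of_sect_subset hMT hXD
  have hND := hNs.le_of_sect_subset hNT hYD
  have hWM := vertex_le hd hW1 hD hW hM hMs hMD
  have hWN := vertex_le hd hW1 hD hW hN hNs hND
  obtain ⟨p, hp, hp0⟩ := W.ne_bot_iff.1 (by rintro rfl; simp at hW1)
  -- If the two generators were orthogonal, their join would be singular of vector dimension at most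
  -- 2, and they would coincide.
  obtain ⟨a, ha, b, hb, hab⟩ : ∃ a ∈ M, ∃ b ∈ N, polar L.coneForm a b ≠ 0 := by
    by_contra! h
    have := finrank_le_of_isQuadric hd hW1 hD (singular_sup hMs hNs h) (sup_le hMD hND)
    have e1 := eq_of_le_of_finrank_le (le_sup_left : M ≤ M ⊔ N) (by omega)
    have e2 := eq_of_le_of_finrank_le (le_sup_right : N ≤ M ⊔ N) (by omega)
    exact hXY (by rw [e1, ← e2])
  obtain ⟨c, hc⟩ : ∃ c, c = (polar L.coneForm a b)⁻¹ • b := ⟨_, rfl⟩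
  have hcN : c ∈ N := hc ▸ N.smul_mem _ hb
  have h : L.IsPair p a c := ⟨hp0, hMs p (hWM hp), hMs a ha, hNs c hcN,
    hMs.polar_eq_zero (hWM hp) ha, hNs.polar_eq_zero (hWN hp) hcN, by
      simp [hc, polar_smul_right, hab]⟩
  have eM : span K {p, a} = M := by
    refine eq_of_le_of_finrank_eq (span_le.2 ?_) (h.finrank_span.trans hM.symm)
    rintro y (rfl | rfl)
    exacts [hWM hp, ha]
  have eN : span K {p, c} = N := by
    refine eq_of_le_of_finrank_eq (span_le.2 ?_) (h.swap.finrank_span.trans hN.symm)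
    rintro y (rfl | rfl)
    exacts [hWN hp, hcN]
  rw [← eM, ← eN]
  exact h.adj h2 hL

/-! ### Characterizations in terms of inclusion -/

lemma mem_lines_iff_exists_adj [FiniteDimensional K V] (h2 : (2 : K) ≠ 0)
    (hL : L.T ≠ ⊥ ∨ 5 ≤ finrank K L.B) {X : Set (ℙ K V)} (hX : X ∈ L.sub₁) :
    X ∈ L.lines ↔ ∃ Y ∈ L.sub₁, L.Adj X Y := by
  constructor
  · intro h
    obtain ⟨A, hA, hs, hT, rfl⟩ := mem_lines_iff.1 h
    obtain ⟨p, a, b, hp, rfl⟩ := exists_isPair_span_eq h2 hA hs hT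
    exact ⟨_, Or.inr hp.swap.mem_lines, hp.adj h2 hL⟩
  · rintro ⟨Y, hY, h⟩
    exact hX.resolve_left fun hc => not_adj_of_mem_cycles hc hY h

lemma not_mem_lines_of_mem_cycles {X : Set (ℙ K V)} (hX : X ∈ L.cycles) : X ∉ L.lines := by
  obtain ⟨A, -, -, -, hl⟩ := hX
  exact fun h => hl X h subset_rfl

lemma mem_of_cycle_subset {X Z : Set (ℙ K V)} (hX : X ∈ L.cycles) (hZ : Z ∈ L.sub₂)
    (hXZ : X ⊆ Z) : ((Z ∈ L.lClass 1 1 0 ∨ Z ∈ L.dClass 1 1 0) ∨ Z ∈ L.lClass 0 2 0) ∨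
      Z ∈ L.lClass 0 2 1 := by
  obtain ⟨A, hA, ⟨e, he, f, hf, hQe, hef⟩, -, rfl⟩ := exists_of_mem_cycles hX
  have key : ∀ m d, Z ∉ L.gClass m d := by
    rintro m d ⟨H, -, hH, -, -, rfl⟩
    have hle := le_of_sect_subset he hf hQe hef hXZ
    exact hef ((pts_subset_iff.1 hH).polar_eq_zero (hle he) (hle hf))
  simpa [sub₂, key] using hZ

lemma not_subset_lClass_0_2_0 [FiniteDimensional K V] {X Z : Set (ℙ K V)} (hX : X ∈ L.lines)
    (hZ : Z ∈ L.lClass 0 2 0) : ¬ X ⊆ Z := by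
  obtain ⟨W, D, -, hD, -, -, hW, rfl⟩ := hZ
  obtain ⟨A, hA, hs, hT, rfl⟩ := mem_lines_iff.1 hX
  intro h
  have hW : W = ⊥ := finrank_eq_zero.1 (by omega)
  have hle := hs.le_of_sect_subset hT h
  rw [hW, bot_sup_eq] at hle
  have := hD.2.2.2 ⟨A, hle, hs, hA⟩
  omega

lemma mem_projLines_of_subset [FiniteDimensional K V] (h2 : (2 : K) ≠ 0) {m d w : ℕ}
    {X Z : Set (ℙ K V)} (hX : X ∈ L.lines) (hZ : Z ∈ L.sClass 0 m d w) (h : X ⊆ Z) :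
    X ∈ L.projLines := by
  obtain ⟨W, D, -, hD, hW, hWT, -, rfl⟩ := hZ
  obtain ⟨A, hA, hs, hT, rfl⟩ := mem_lines_iff.1 hX
  refine mem_projLines_iff.2 ⟨A, hA, hs, ?_, rfl⟩
  rw [eq_bot_iff, ← finrank_eq_zero.1 hWT]
  exact fun x hx => ⟨mem_vertex_of_mem_T h2 hW hD.2.1 (hs.le_of_sect_subset hT h hx.1) hx.2, hx.2⟩

lemma mem_projLines_iff_exists [FiniteDimensional K V] (h2 : (2 : K) ≠ 0)
    (hL : L.T ≠ ⊥ ∨ 5 ≤ finrank K L.B) {X : Set (ℙ K V)} :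
    X ∈ L.projLines ↔ X ∈ L.lines ∧ ∃ Z ∈ L.sub₂, X ⊆ Z ∧ (∃ C ∈ L.cycles, C ⊆ Z) ∧
      ∃ Y ∈ L.lines, Y ⊆ Z ∧ X ≠ Y ∧ ¬ L.Adj X Y := by
  constructor
  · intro hX
    refine ⟨projLines_subset_lines hX, ?_⟩
    obtain ⟨A, hA, hs, hT, rfl⟩ := mem_projLines_iff.1 hX
    obtain ⟨p, d, a, b, h, rfl, -⟩ := exists_isHyp_span_eq hA hs (le_top (a := A))
      fun x hx hx0 => by
        obtain ⟨y, hy⟩ := L.exists_polar_ne h2 (x := x) fun hxT =>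
          hx0 ((mem_bot K).1 (hT ▸ ⟨hx, hxT⟩))
        exact ⟨y, mem_top, hy⟩
    have hm : ∀ i, ![p, d, a, b] i ∈ span K (Set.range ![p, d, a, b]) :=
      fun i => subset_span ⟨i, rfl⟩
    refine ⟨_, h.mem_sub₂ h2, sect_mono (span_le.2 ?_),
      ⟨_, ((h.isConic one_ne_zero).isQuadric h2).mem_cycles h2, sect_mono (span_le.2 ?_)⟩,
      _, h.symm.mem_lines, sect_mono (span_le.2 ?_), fun he => ?_, h.not_adj⟩
    · rintro y (rfl | rfl)
      exacts [hm 0, hm 2]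
    · rintro _ ⟨i, rfl⟩
      fin_cases i
      exacts [hm 2, hm 3, add_mem (hm 0) (smul_mem _ _ (hm 1))]
    · rintro y (rfl | rfl)
      exacts [hm 1, hm 3]
    · have hle := h.symm.singular.le_of_sect_subset h.symm.not_le he.symm.subset
      have := h.singular.polar_eq_zero (x := p) (y := d) (subset_span (by simp))
        (hle (subset_span (by simp)))
      rw [h.pd] at this
      exact one_ne_zero this
  · rintro ⟨hX, Z, hZ, hXZ, ⟨C, hC, hCZ⟩, Y, hY, hYZ, hne, hadj⟩
    -- The cases are affine cone, projective cone, Möbius plane, Minkowski plane. The second is in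
    -- fact vacuous, but its lines miss `T` anyway.
    rcases mem_of_cycle_subset hC hZ hCZ with ((hZ | hZ) | hZ) | hZ
    · obtain ⟨W, D, hd, hD, hW, -, hW1, rfl⟩ := hZ
      exact absurd (adj_of_cone h2 hL hd hW1 hD hW hX hY hXZ hYZ hne) hadj
    · exact mem_projLines_of_subset h2 hX hZ hXZ
    · exact absurd hXZ (not_subset_lClass_0_2_0 hX hZ)
    · exact mem_projLines_of_subset h2 hX hZ hXZ

lemma mem_dClass_iff [FiniteDimensional K V] (h2 : (2 : K) ≠ 0)
    (hL : L.T ≠ ⊥ ∨ 5 ≤ finrank K L.B) {Z : Set (ℙ K V)} (hZ : Z ∈ L.sub₂) :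
    Z ∈ L.dClass 1 1 0 ↔ (∃ C ∈ L.cycles, C ⊆ Z) ∧ (∃ X ∈ L.projLines, X ⊆ Z) ∧
      ∀ X ∈ L.lines, ∀ Y ∈ L.lines, X ⊆ Z → Y ⊆ Z → X ≠ Y → L.Adj X Y := by
  constructor
  · intro hZd
    obtain ⟨W, D, hd, hD, hW, hWT, hW1, rfl⟩ := id hZd
    refine ⟨⟨_, hD.mem_cycles h2, sect_mono le_sup_right⟩, ?_, fun X hX Y hY hXZ hYZ hne =>
      adj_of_cone h2 hL hd hW1 hD hW hX hY hXZ hYZ hne⟩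
    obtain ⟨p, hp, hp0⟩ := W.ne_bot_iff.1 (by rintro rfl; simp at hW1)
    obtain ⟨U, hUD, hU, hU1⟩ := hD.2.2.1
    obtain ⟨e, he, he0⟩ := U.ne_bot_iff.1 (by rintro rfl; simp at hU1)
    have hQp : L.coneForm p = 0 := by simpa using hW p hp 0 (zero_mem _)
    have hle : span K {p, e} ≤ W ⊔ D := by
      rw [span_le]
      rintro y (rfl | rfl)
      exacts [mem_sup_left hp, mem_sup_right (hUD he)]
    refine ⟨_, mem_projLines_iff.2 ⟨span K {p, e}, finrank_span_pair_eq_two hp0 fun h => he0 ?_,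
      singular_span_pair hQp (hU e he) (polar_eq_zero_of_cone hW hp (hUD he)), ?_, rfl⟩,
      sect_mono hle⟩
    · exact disjoint_def.1 hd e ((span_singleton_le_iff_mem p W).2 hp h) (hUD he)
    · rw [eq_bot_iff, ← finrank_eq_zero.1 hWT]
      exact fun x hx => ⟨mem_vertex_of_mem_T h2 hW hD.2.1 (hle hx.1) hx.2, hx.2⟩
  · rintro ⟨⟨C, hC, hCZ⟩, ⟨X, hX, hXZ⟩, hadj⟩
    rcases mem_of_cycle_subset hC hZ hCZ with ((hZ | hZ) | hZ) | hZ
    · exfalso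
      obtain ⟨W, D, hd, hD, hW, hWT, hW1, rfl⟩ := hZ
      obtain ⟨A, hA, hs, hT, rfl⟩ := mem_projLines_iff.1 hX
      have hle := vertex_le hd hW1 hD hW hA hs
        (hs.le_of_sect_subset (not_le_of_inf_eq_bot hA hT) hXZ)
      have : W ⊓ L.T = ⊥ := by
        rw [eq_bot_iff, ← hT]
        exact inf_le_inf_right _ hle
      rw [this, finrank_bot] at hWT
      omega
    · exact hZ
    · exact absurd hXZ (not_subset_lClass_0_2_0 (projLines_subset_lines hX) hZ)
    · exfalso
      obtain ⟨W, D, -, hD, -, -, hW, rfl⟩ := hZ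
      obtain ⟨U, hUD, hs, hU⟩ := hD.2.2.1
      have hn := (L.nondegenerate_comp_subtype_iff h2 D).1 hD.2.1
      -- A generator of a Minkowski plane is completed to a hyperbolic basis; the opposite generator
      -- is skew to it, contradicting adjacency.
      obtain ⟨p, d, a, b, h, rfl, hle⟩ := exists_isHyp_span_eq hU hs hUD fun x hx hx0 => by
        by_contra! hx'
        exact hx0 (hn x (hUD hx) hx')
      have hm : ∀ i, ![p, d, a, b] i ∈ W ⊔ D :=
        fun i => mem_sup_right (hle (subset_span ⟨i, rfl⟩))
      refine h.not_adj (hadj _ h.mem_lines _ h.symm.mem_lines (sect_mono (span_le.2 ?_))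
        (sect_mono (span_le.2 ?_)) fun he => ?_)
      · rintro y (rfl | rfl)
        exacts [hm 0, hm 2]
      · rintro y (rfl | rfl)
        exacts [hm 1, hm 3]
      · have hle := h.symm.singular.le_of_sect_subset h.symm.not_le he.symm.subset
        have := h.singular.polar_eq_zero (x := p) (y := d) (subset_span (by simp))
          (hle (subset_span (by simp)))
        rw [h.pd] at this
        exact one_ne_zero this

end GenLaguerre

/-! ### Formulas with named variables -/

namespace GrassFormula

open FirstOrder.Language

/-- Existential quantification over the variable `k`. -/
noncomputable def ex (k : ℕ) (φ : grassLanguage.Formula ℕ) : grassLanguage.Formula ℕ :=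
  Formula.iExs Unit
    (φ.relabel fun j => if j = k then Sum.inr () else Sum.inl j)

/-- The variable `i` is contained in the variable `j`. -/
def incl (i j : ℕ) : grassLanguage.Formula ℕ :=
  Relations.formula₂ (L := grassLanguage) GrassRel.incl (Term.var i) (Term.var j)

/-- The variables `i` and `j` have distinct values. -/
def ne (i j : ℕ) : grassLanguage.Formula ℕ :=
  ∼(Term.equal (Term.var i) (Term.var j))

variable {M : Type*} [grassLanguage.Structure M] {x : ℕ → M}

/-- The interpretation of the inclusion symbol. -/
def Incl (a b : M) : Prop :=
  Structure.RelMap (L := grassLanguage) (n := 2) GrassRel.incl ![a, b]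

@[simp]
lemma realize_ex {k : ℕ} {φ : grassLanguage.Formula ℕ} :
    (ex k φ).Realize x ↔ ∃ a : M, φ.Realize (Function.update x k a) := by
  have h : ∀ i : Unit → M, (Sum.elim x i ∘ fun j => if j = k then Sum.inr () else Sum.inl j) =
      Function.update x k (i ()) := by
    intro i
    ext j
    by_cases hj : j = k
    · subst hj; simp
    · simp [hj]
  simp only [ex, Formula.realize_iExs, Formula.realize_relabel, h]
  exact ⟨fun ⟨i, hi⟩ => ⟨i (), hi⟩, fun ⟨a, ha⟩ => ⟨fun _ => a, ha⟩⟩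

@[simp]
lemma realize_incl {i j : ℕ} : (incl i j).Realize x ↔ Incl (x i) (x j) :=
  Formula.realize_rel₂

@[simp]
lemma realize_ne {i j : ℕ} : (ne i j).Realize x ↔ x i ≠ x j := by
  simp [ne]

/-- The variables `i` and `j` are contained in at least two common elements. -/
noncomputable def adj (i j : ℕ) : grassLanguage.Formula ℕ :=
  ne i j ⊓ ex 10 (ex 11 (ne 10 11 ⊓ (incl i 10 ⊓ (incl j 10 ⊓ (incl i 11 ⊓ incl j 11)))))

/-- The variable `i` is a line. -/
noncomputable def line (i : ℕ) : grassLanguage.Formula ℕ := ex 9 (adj i 9)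

/-- The variable `j` contains a cycle. -/
noncomputable def cyc (j : ℕ) : grassLanguage.Formula ℕ := ex 8 (incl 8 j ⊓ ∼(line 8))

/-- The variable `i` is a projective line. -/
noncomputable def proj (i : ℕ) : grassLanguage.Formula ℕ :=
  line i ⊓ ex 6 (incl i 6 ⊓ (cyc 6 ⊓ ex 7 (line 7 ⊓ (incl 7 6 ⊓ (ne i 7 ⊓ ∼(adj i 7))))))

/-- The variable `j` is a projective cone. -/
noncomputable def cone (j : ℕ) : grassLanguage.Formula ℕ :=
  cyc j ⊓ (ex 4 (proj 4 ⊓ incl 4 j) ⊓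
    ∼(ex 4 (ex 5 (line 4 ⊓ (line 5 ⊓ (incl 4 j ⊓ (incl 5 j ⊓ (ne 4 5 ⊓ ∼(adj 4 5)))))))))

/-- Two elements contained in at least two common elements. -/
def Adj (a b : M) : Prop :=
  a ≠ b ∧ ∃ z w : M, z ≠ w ∧ Incl a z ∧ Incl b z ∧ Incl a w ∧ Incl b w

/-- The elements that satisfy the formula for lines. -/
def Line (a : M) : Prop := ∃ b : M, Adj a b

/-- The elements that satisfy the formula for the existence of a cycle. -/
def Cyc (z : M) : Prop := ∃ c : M, Incl c z ∧ ¬ Line c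

/-- The elements that satisfy the formula for projective lines. -/
def Proj (a : M) : Prop :=
  Line a ∧ ∃ z : M, Incl a z ∧ Cyc z ∧ ∃ b : M, Line b ∧ Incl b z ∧ a ≠ b ∧ ¬ Adj a b

/-- The elements that satisfy the formula for projective cones. -/
def Cone (z : M) : Prop :=
  Cyc z ∧ (∃ a : M, Proj a ∧ Incl a z) ∧
    ¬ ∃ a b : M, Line a ∧ Line b ∧ Incl a z ∧ Incl b z ∧ a ≠ b ∧ ¬ Adj a b

/-- Each named formula binds fixed variables, and the nested ones use larger indices; the bound on
the free index prevents capture. -/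
lemma realize_adj {i j : ℕ} (hi : i < 10) (hj : j < 10) :
    (adj i j).Realize x ↔ Adj (x i) (x j) := by
  simp [adj, Adj, hi.ne, hj.ne, (hi.trans (by decide : 10 < 11)).ne,
    (hj.trans (by decide : 10 < 11)).ne]

lemma realize_line {i : ℕ} (hi : i < 9) : (line i).Realize x ↔ Line (x i) := by
  simp [line, Line, realize_adj (hi.trans (by decide : 9 < 10)), hi.ne]

lemma realize_cyc {j : ℕ} (hj : j < 8) : (cyc j).Realize x ↔ Cyc (x j) := by
  simp [cyc, Cyc, realize_line, hj.ne]

lemma realize_proj {i : ℕ} (hi : i < 6) : (proj i).Realize x ↔ Proj (x i) := by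
  have h7 : i ≠ 7 := by omega
  simp [proj, Proj, realize_line, realize_adj, realize_cyc, hi.ne, h7,
    (by omega : i < 9), (by omega : i < 10)]

lemma realize_cone {j : ℕ} (hj : j < 4) : (cone j).Realize x ↔ Cone (x j) := by
  have h5 : j ≠ 5 := by omega
  simp [cone, Cone, realize_line, realize_adj, realize_cyc, realize_proj, hj.ne, h5,
    (by omega : j < 8)]

end GrassFormula

/-! ### Meaning of the formulas in the Grassmann space -/

namespace GenLaguerre

variable {K : Type u} {V : Type v} [Field K] [AddCommGroup V] [Module K V] {L : GenLaguerre K V}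

lemma incl_iff {a b : L.Gr} : GrassFormula.Incl a b ↔
    ∃ (Y : L.sub₁) (Z : L.sub₂), a = Sum.inl Y ∧ b = Sum.inr Z ∧ (Y : Set (ℙ K V)) ⊆ Z :=
  Iff.rfl

lemma incl_inl_inr {Y : L.sub₁} {Z : L.sub₂} :
    GrassFormula.Incl (M := L.Gr) (Sum.inl Y) (Sum.inr Z) ↔ (Y : Set (ℙ K V)) ⊆ Z := by
  constructor
  · intro h
    obtain ⟨Y', Z', h1, h2, h⟩ := incl_iff.1 h
    rwa [Sum.inl_injective h1, Sum.inr_injective h2]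
  · exact fun h => incl_iff.2 ⟨Y, Z, rfl, rfl, h⟩

lemma exists_incl {a b : L.Gr} (h : GrassFormula.Incl a b) :
    (∃ Y : L.sub₁, a = Sum.inl Y) ∧ ∃ Z : L.sub₂, b = Sum.inr Z := by
  obtain ⟨Y, Z, rfl, rfl, -⟩ := incl_iff.1 h
  exact ⟨⟨Y, rfl⟩, Z, rfl⟩

lemma adj_iff {X Y : L.sub₁} :
    GrassFormula.Adj (M := L.Gr) (Sum.inl X) (Sum.inl Y) ↔ L.Adj X Y := by
  constructor
  · rintro ⟨h, z, w, hzw, h1, h2, h3, h4⟩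
    obtain ⟨-, Z, rfl⟩ := exists_incl h1
    obtain ⟨-, W, rfl⟩ := exists_incl h3
    exact ⟨fun he => h (congrArg Sum.inl (Subtype.ext he)), Z, Z.2, W, W.2,
      fun he => hzw (congrArg Sum.inr (Subtype.ext he)), incl_inl_inr.1 h1, incl_inl_inr.1 h2,
      incl_inl_inr.1 h3, incl_inl_inr.1 h4⟩
  · rintro ⟨h, Z, hZ, W, hW, hZW, h1, h2, h3, h4⟩
    refine ⟨fun he => h (congrArg Subtype.val (Sum.inl_injective he)), Sum.inr ⟨Z, hZ⟩,
      Sum.inr ⟨W, hW⟩, fun he => hZW (congrArg Subtype.val (Sum.inr_injective he)),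
      incl_inl_inr.2 h1, incl_inl_inr.2 h2, incl_inl_inr.2 h3, incl_inl_inr.2 h4⟩

lemma line_iff [FiniteDimensional K V] (h2 : (2 : K) ≠ 0)
    (hL : L.T ≠ ⊥ ∨ 5 ≤ finrank K L.B) {X : L.sub₁} :
    GrassFormula.Line (M := L.Gr) (Sum.inl X) ↔ (X : Set (ℙ K V)) ∈ L.lines := by
  rw [mem_lines_iff_exists_adj h2 hL X.2]
  constructor
  · rintro ⟨b, hb⟩
    obtain ⟨-, z, w, -, -, h, -⟩ := id hb
    obtain ⟨⟨Y, rfl⟩, -⟩ := exists_incl h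
    exact ⟨Y, Y.2, adj_iff.1 hb⟩
  · rintro ⟨Y, hY, h⟩
    exact ⟨Sum.inl ⟨Y, hY⟩, adj_iff.2 h⟩

lemma cyc_iff [FiniteDimensional K V] (h2 : (2 : K) ≠ 0)
    (hL : L.T ≠ ⊥ ∨ 5 ≤ finrank K L.B) {Z : L.sub₂} :
    GrassFormula.Cyc (M := L.Gr) (Sum.inr Z) ↔ ∃ C ∈ L.cycles, C ⊆ Z := by
  constructor
  · rintro ⟨c, hc, hl⟩
    obtain ⟨⟨C, rfl⟩, -⟩ := exists_incl hc
    exact ⟨C, C.2.resolve_right fun h => hl ((line_iff h2 hL).2 h), incl_inl_inr.1 hc⟩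
  · rintro ⟨C, hC, h⟩
    exact ⟨Sum.inl ⟨C, Or.inl hC⟩, incl_inl_inr.2 h,
      fun hl => not_mem_lines_of_mem_cycles hC ((line_iff h2 hL).1 hl)⟩

lemma proj_iff [FiniteDimensional K V] (h2 : (2 : K) ≠ 0)
    (hL : L.T ≠ ⊥ ∨ 5 ≤ finrank K L.B) {X : L.sub₁} :
    GrassFormula.Proj (M := L.Gr) (Sum.inl X) ↔ (X : Set (ℙ K V)) ∈ L.projLines := by
  rw [mem_projLines_iff_exists h2 hL]
  refine and_congr (line_iff h2 hL) ⟨?_, ?_⟩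
  · rintro ⟨z, h1, h3, b, hb, hbz, hne, hadj⟩
    obtain ⟨-, Z, rfl⟩ := exists_incl h1
    obtain ⟨⟨Y, rfl⟩, -⟩ := exists_incl hbz
    exact ⟨Z, Z.2, incl_inl_inr.1 h1, (cyc_iff h2 hL).1 h3, Y, (line_iff h2 hL).1 hb,
      incl_inl_inr.1 hbz, fun he => hne (congrArg Sum.inl (Subtype.ext he)),
      fun h => hadj (adj_iff.2 h)⟩
  · rintro ⟨Z, hZ, h1, h3, Y, hY, hYZ, hne, hadj⟩
    exact ⟨Sum.inr ⟨Z, hZ⟩, incl_inl_inr.2 h1, (cyc_iff h2 hL).2 h3, Sum.inl ⟨Y, Or.inr hY⟩,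
      (line_iff h2 hL).2 hY, incl_inl_inr.2 hYZ,
      fun he => hne (congrArg Subtype.val (Sum.inl_injective he)), fun h => hadj (adj_iff.1 h)⟩

lemma cone_iff [FiniteDimensional K V] (h2 : (2 : K) ≠ 0)
    (hL : L.T ≠ ⊥ ∨ 5 ≤ finrank K L.B) {Z : L.sub₂} :
    GrassFormula.Cone (M := L.Gr) (Sum.inr Z) ↔ (Z : Set (ℙ K V)) ∈ L.dClass 1 1 0 := by
  rw [mem_dClass_iff h2 hL Z.2]
  refine and_congr (cyc_iff h2 hL) (and_congr ⟨?_, ?_⟩ ⟨?_, ?_⟩)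
  · rintro ⟨a, ha, haz⟩
    obtain ⟨⟨X, rfl⟩, -⟩ := exists_incl haz
    exact ⟨X, (proj_iff h2 hL).1 ha, incl_inl_inr.1 haz⟩
  · rintro ⟨X, hX, hXZ⟩
    exact ⟨Sum.inl ⟨X, Or.inr (projLines_subset_lines hX)⟩, (proj_iff h2 hL).2 hX,
      incl_inl_inr.2 hXZ⟩
  · intro h X hX Y hY hXZ hYZ hne
    by_contra hadj
    exact h ⟨Sum.inl ⟨X, Or.inr hX⟩, Sum.inl ⟨Y, Or.inr hY⟩, (line_iff h2 hL).2 hX,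
      (line_iff h2 hL).2 hY, incl_inl_inr.2 hXZ, incl_inl_inr.2 hYZ,
      fun he => hne (congrArg Subtype.val (Sum.inl_injective he)), fun h => hadj (adj_iff.1 h)⟩
  · rintro h ⟨a, b, ha, hb, haz, hbz, hne, hadj⟩
    obtain ⟨⟨X, rfl⟩, -⟩ := exists_incl haz
    obtain ⟨⟨Y, rfl⟩, -⟩ := exists_incl hbz
    exact hadj (adj_iff.2 (h X ((line_iff h2 hL).1 ha) Y ((line_iff h2 hL).1 hb)
      (incl_inl_inr.1 haz) (incl_inl_inr.1 hbz)
      fun he => hne (congrArg Sum.inl (Subtype.ext he))))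

lemma proj_iff_exists [FiniteDimensional K V] (h2 : (2 : K) ≠ 0)
    (hL : L.T ≠ ⊥ ∨ 5 ≤ finrank K L.B) {a : L.Gr} : GrassFormula.Proj a ↔
    ∃ Y : L.sub₁, a = Sum.inl Y ∧ (Y : Set (ℙ K V)) ∈ L.projLines := by
  constructor
  · intro h
    obtain ⟨-, z, haz, -⟩ := id h
    obtain ⟨⟨Y, rfl⟩, -⟩ := exists_incl haz
    exact ⟨Y, rfl, (proj_iff h2 hL).1 h⟩
  · rintro ⟨Y, rfl, hY⟩
    exact (proj_iff h2 hL).2 hY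

lemma cone_iff_exists [FiniteDimensional K V] (h2 : (2 : K) ≠ 0)
    (hL : L.T ≠ ⊥ ∨ 5 ≤ finrank K L.B) {a : L.Gr} : GrassFormula.Cone a ↔
    ∃ Z : L.sub₂, a = Sum.inr Z ∧ (Z : Set (ℙ K V)) ∈ L.dClass 1 1 0 := by
  constructor
  · intro h
    obtain ⟨⟨c, hc, -⟩, -⟩ := id h
    obtain ⟨-, Z, rfl⟩ := exists_incl hc
    exact ⟨Z, rfl, (cone_iff h2 hL).1 h⟩
  · rintro ⟨Z, rfl, hZ⟩
    exact (cone_iff h2 hL).2 hZ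

end GenLaguerre

/-- There are first-order formulas without parameters, the same for all generalized Laguerre spaces,
which define in the Grassmann space `⟨℘₁, ℘₂, ⊂⟩` the universes and the relation of the structure
`⟨𝒢, 𝔡¹_{1,0}, ⊂⟩` of conic pencils. -/
theorem mainTheorem2 :
    ∃ (φG φC : grassLanguage.Formula (Fin 1)) (φI : grassLanguage.Formula (Fin 2)),
      ∀ (K : Type u) (V : Type v) [Field K] [AddCommGroup V] [Module K V] [FiniteDimensional K V]
        (L : GenLaguerre K V), (2 : K) ≠ 0 → (L.T ≠ ⊥ ∨ 5 ≤ finrank K L.B) →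
        (∀ x : Fin 1 → L.Gr, φG.Realize x ↔
          ∃ Y : L.sub₁, x 0 = Sum.inl Y ∧ (Y : Set (ℙ K V)) ∈ L.projLines) ∧
        (∀ x : Fin 1 → L.Gr, φC.Realize x ↔
          ∃ Z : L.sub₂, x 0 = Sum.inr Z ∧ (Z : Set (ℙ K V)) ∈ L.dClass 1 1 0) ∧
        (∀ x : Fin 2 → L.Gr, φI.Realize x ↔
          ∃ (Y : L.sub₁) (Z : L.sub₂), x 0 = Sum.inl Y ∧ x 1 = Sum.inr Z ∧
            (Y : Set (ℙ K V)) ∈ L.projLines ∧ (Z : Set (ℙ K V)) ∈ L.dClass 1 1 0 ∧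
            (Y : Set (ℙ K V)) ⊆ Z) := by
  -- The truth of these formulas depends only on the variables 0 and 1, so the remaining names may
  -- be sent to any index.
  refine ⟨(GrassFormula.proj 0).relabel fun _ => 0, (GrassFormula.cone 0).relabel fun _ => 0,
    (GrassFormula.proj 0 ⊓ (GrassFormula.cone 1 ⊓ GrassFormula.incl 0 1)).relabel
      fun n => if n = 0 then 0 else 1, ?_⟩
  intro K V _ _ _ _ L h2 hL
  refine ⟨fun x => ?_, fun x => ?_, fun x => ?_⟩
  · rw [Language.Formula.realize_relabel, GrassFormula.realize_proj (by decide)]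
    exact GenLaguerre.proj_iff_exists h2 hL
  · rw [Language.Formula.realize_relabel, GrassFormula.realize_cone (by decide)]
    exact GenLaguerre.cone_iff_exists h2 hL
  · rw [Language.Formula.realize_relabel, Language.Formula.realize_inf,
      Language.Formula.realize_inf, GrassFormula.realize_proj (by decide),
      GrassFormula.realize_cone (by decide), GrassFormula.realize_incl]
    simp only [Function.comp_apply, if_true, one_ne_zero, if_false]
    rw [GenLaguerre.proj_iff_exists h2 hL, GenLaguerre.cone_iff_exists h2 hL]
    constructor
    · rintro ⟨⟨Y, hxY, hY⟩, ⟨Z, hxZ, hZ⟩, h⟩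
      rw [hxY, hxZ] at h
      exact ⟨Y, Z, hxY, hxZ, hY, hZ, GenLaguerre.incl_inl_inr.1 h⟩
    · rintro ⟨Y, Z, hxY, hxZ, hY, hZ, h⟩
      refine ⟨⟨Y, hxY, hY⟩, ⟨Z, hxZ, hZ⟩, ?_⟩
      rw [hxY, hxZ]
      exact GenLaguerre.incl_inl_inr.2 h
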